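/- Throughout, $\Omega\subset\mathbb{R}^2$ is a compact set whose boundary $\partial\Omega$ is a simple closed continuously differentiable curve of length $L$, and $\gamma:[0,L]\to\partial\Omega$ is an arclength parameterization of it, traversed counterclockwise, i.e. with the interior of $\Omega$ on the left (extended $L$-periodically to $\mathbb{R}$). Write $D(p,r)$ for the closed disk of radius $r$ about $p$, and let \[ g(s,r)=\operatorname{area}\bigl(\Omega\cap D(\gamma(s),r)\bigr),\qquad g_s=\frac{\partial g}{\partial s},\quad g_r=\frac{\partial g}{\partial r}. \] The curve is called tangentially graph-like (TGL) for the radius $r$ if for every $p\in\partial\Omega$ there is a Cartesian coordinate system centred at $p$ in which $\partial\Omega\cap D(p,r)$ is the graph of a function $f$, defined on a neighbourhood of $0$ in its first coordinate axis or on a larger subset of that axis, with $f(0)=0$ and $f'(0)=0$. Let $\hat r>0$ and $\hat s\in[0,L]$. Then every curve $\gamma$ that is TGL for $\hat r$ is determined, up to rotation and translation of the plane, by the values of $g$, $g_s$ and $g_r$ on the T-shaped set \[ T=\bigl([0,L]\times\{\hat r\}\bigr)\cup\bigl(\{\hat s\}\times(0,\hat r]\bigr). \] Precisely: let $(\Omega_1,\gamma_1)$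 and $(\Omega_2,\gamma_2)$ be two pairs as above, with the same length $L$, both TGL for $\hat r$. If the functions $g,g_s,g_r$ of the first pair agree with those of the second pair at every point of $T$, then there are a rotation $R$ of the plane about the origin and a vector $b\in\mathbb{R}^2$ such that $\gamma_2(s)=R\gamma_1(s)+b$ for all $s\in[0,L]$. (In particular, $\gamma$ is determined up to reparametrization, translation and rotation.) -/

import Mathlib

open scoped Topology

/-- The plane `ℝ²` is modelled by `ℂ`. `IsC1Shape Ω L γ` says that `Ω` is a compact planar set
whose topological boundary is a simple closed continuously differentiable curve of length `L`, and
that `γ` is an arclength parameterization of that boundary keeping the interior of `Ω` on the left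
(i.e. counterclockwise). The parameterization on `[0, L]` is represented by its `L`-periodic
extension to `ℝ`, so that continuous differentiability includes the closing point. -/
structure IsC1Shape (Ω : Set ℂ) (L : ℝ) (γ : ℝ → ℂ) : Prop where
  isCompact : IsCompact Ω
  length_pos : 0 < L
  contDiff : ContDiff ℝ 1 γ
  unit_speed : ∀ s, ‖deriv γ s‖ = 1
  periodic : Function.Periodic γ L
  injOn : Set.InjOn γ (Set.Ico 0 L)
  image_eq : γ '' Set.Ico 0 L = frontier Ω
  interior_left : ∀ s, ∀ᶠ ε : ℝ in 𝓝[>] 0,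
    γ s + (ε : ℂ) * (Complex.I * deriv γ s) ∈ interior Ω

/-- The curve `C` is tangentially graph-like at `p` for the radius `r`: there is a Cartesian
coordinate system centred at `p` (with first axis along the unit vector `u` and second axis along
`I * u`) in which `C ∩ D(p, r)` is the graph of a function `f`, on a domain `A` that is a
neighbourhood of `0`, with `f 0 = 0` and `f' 0 = 0`. -/
def IsTGLAt (C : Set ℂ) (p : ℂ) (r : ℝ) : Prop :=
  ∃ (u : ℂ) (A : Set ℝ) (f : ℝ → ℝ), ‖u‖ = 1 ∧ A ∈ 𝓝 (0 : ℝ) ∧ f 0 = 0 ∧ HasDerivAt f 0 0 ∧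
    C ∩ Metric.closedBall p r = (fun x : ℝ => p + u * ((x : ℂ) + (f x : ℂ) * Complex.I)) '' A

/-- The curve `C` is tangentially graph-like for the radius `r`. -/
def IsTGL (C : Set ℂ) (r : ℝ) : Prop :=
  ∀ p ∈ C, IsTGLAt C p r

/-- The integral area invariant `g(s, r) = area (Ω ∩ D(γ(s), r))`. -/
noncomputable def areaInvariant (Ω : Set ℂ) (γ : ℝ → ℂ) (s r : ℝ) : ℝ :=
  (MeasureTheory.volume (Ω ∩ Metric.closedBall (γ s) r)).toReal

/-- The T-shaped set `([0, L] × {r̂}) ∪ ({ŝ} × (0, r̂])`. -/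
def tSet (L rhat shat : ℝ) : Set (ℝ × ℝ) :=
  Set.Icc 0 L ×ˢ {rhat} ∪ {shat} ×ˢ Set.Ioc 0 rhat

/-! ### Distance functions along a curve without critical distances. -/

open scoped Topology

/-! The graph condition enters through one consequence, `inner_ne_zero_of_isTGL`: a chord of length
at most `r` is never orthogonal to the curve at an endpoint, because the normal line at the centre
meets the graph only at the centre. So the distance to a fixed point `γ s` has no critical value in
`(0, r]`, and for every `ρ ≤ r` the curve leaves the disk of radius `ρ` about `γ s` once forwards
and once backwards (`exists_peak`, `exists_forward_or_backward`).

Let `α` and `β` be the angles of these two exit points, measured from the tangent at `γ s`. A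
connectedness argument shows that the circle of radius `ρ` lies in `Ω` for angles between `α` and
`β` and outside `Ω` for the remaining angles (`framePoint_mem_interior`, `framePoint_notMem`).
Differentiating the area in polar coordinates gives `g_r = ρ (β - α)` and `g_s = ρ (sin β - sin α)`.
Since `α` lies in the open right half-plane of directions and `β` in the left one, these two numbers
determine `α` (`eq_of_sub_eq_of_sin_sub_sin_eq`), hence the forward exit point relative to position
and tangent.

The curve is then rebuilt in `congr_of_exitPoint_eq`. The stem of the T gives the forward exit
points of all radii at one base point, that is, an initial arc. Along a known arc position and
tangent are known, so the bar of the T gives the exit points at radius `r`, which continue the arc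
by at least `r`. Exit points come without their arclength parameter; it is recovered because the
length of an arc is its variation, which does not depend on a monotone parametrization
(`eq_of_unitSpeed_comp_eq`). -/

/-- A closed unit-speed curve of length `L` whose distance functions to its own points have no
critical value in `(0, r]`. -/
structure NoncriticalCurve (γ : ℝ → ℂ) (L r : ℝ) : Prop where
  contDiff : ContDiff ℝ 1 γ
  length_pos : 0 < L
  radius_pos : 0 < r
  unit_speed : ∀ s, ‖deriv γ s‖ = 1
  periodic : Function.Periodic γ L
  ne_of_lt : ∀ s t, s < t → t < s + L → γ t ≠ γ s
  noncritical : ∀ s t, γ t ≠ γ s → ‖γ t - γ s‖ ≤ r → inner ℝ (γ t - γ s) (deriv γ t) ≠ 0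

/-- The arc of `γ` from `s` to `t` stays within distance `r` of its initial point. -/
def StaysClose (γ : ℝ → ℂ) (r s t : ℝ) : Prop :=
  s ≤ t ∧ ∀ u ∈ Set.Icc s t, ‖γ u - γ s‖ ≤ r

/-- If `h y ≤ h x`, the minimum of `h` over `[x, m]` is attained in the interior: at `m` the value
is too large, and if `x` is a minimizer then so is `y`. This is a forbidden local minimum. -/
theorem lt_of_forall_not_isLocalMin {h : ℝ → ℝ} (hc : Continuous h) {a m M : ℝ} (hm : M < h m)
    (hcrit : ∀ z ∈ Set.Ioo a m, h z ≤ M → ¬ IsLocalMin h z) {x y : ℝ} (hax : a ≤ x)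
    (hxy : x < y) (hym : y ≤ m) (hx : h x ≤ M) : h x < h y := by
  by_contra! hle
  have hyM : h y ≤ M := hle.trans hx
  have hy : y < m := lt_of_le_of_ne hym (by rintro rfl; linarith)
  have key : ∀ z ∈ Set.Ioo x m, (∀ w ∈ Set.Icc x m, h z ≤ h w) → h z ≤ M → False := by
    intro z hz hmin hzM
    refine hcrit z ⟨by linarith [hz.1], hz.2⟩ hzM ?_
    filter_upwards [Icc_mem_nhds hz.1 hz.2] with w hw using hmin w hw
  obtain ⟨z, hz, hmin⟩ := isCompact_Icc.exists_isMinOn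
    (Set.nonempty_Icc.2 (hxy.le.trans hym)) (hc.continuousOn (s := Set.Icc x m))
  have hmin' : ∀ w ∈ Set.Icc x m, h z ≤ h w := fun w hw => hmin hw
  have h1 := hmin' y ⟨hxy.le, hym⟩
  rcases eq_or_lt_of_le hz.1 with h2 | h2
  · subst h2
    refine key y ⟨hxy, hy⟩ (fun w hw => hle.trans (hmin' w hw)) hyM
  · rcases eq_or_lt_of_le hz.2 with h3 | h3
    · subst h3; linarith
    · exact key z ⟨h2, h3⟩ hmin' (by linarith)

namespace NoncriticalCurve

variable {γ : ℝ → ℂ} {L r : ℝ}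

theorem hasDerivAt (h : NoncriticalCurve γ L r) (t : ℝ) : HasDerivAt γ (deriv γ t) t :=
  (h.contDiff.differentiable one_ne_zero t).hasDerivAt

theorem continuous (h : NoncriticalCurve γ L r) : Continuous γ := h.contDiff.continuous

theorem norm_sub_le (h : NoncriticalCurve γ L r) (s t : ℝ) : ‖γ t - γ s‖ ≤ |t - s| := by
  have := Convex.norm_image_sub_le_of_norm_deriv_le (f := γ) (C := 1) (s := Set.univ)
    (fun x _ => h.contDiff.differentiable one_ne_zero x) (fun x _ => (h.unit_speed x).le)
    convex_univ (Set.mem_univ s) (Set.mem_univ t)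
  simpa using this

/-- Backward arcs are forward arcs of the reversed curve, so only forward arcs need a theory. -/
theorem reverse (h : NoncriticalCurve γ L r) : NoncriticalCurve (fun t => γ (-t)) L r where
  contDiff := h.contDiff.comp contDiff_neg
  length_pos := h.length_pos
  radius_pos := h.radius_pos
  unit_speed s := by rw [deriv_comp_neg, norm_neg, h.unit_speed]
  periodic t := by
    simp only [neg_add, ← sub_eq_add_neg, h.periodic.sub_eq]
  ne_of_lt s t h1 h2 := (h.ne_of_lt (-t) (-s) (by linarith) (by linarith)).symm
  noncritical s t h1 h2 := by
    rw [deriv_comp_neg, inner_neg_right, neg_ne_zero]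
    exact h.noncritical _ _ h1 h2

theorem not_isLocalExtr (h : NoncriticalCurve γ L r) {s t : ℝ} (hne : γ t ≠ γ s)
    (hle : ‖γ t - γ s‖ ≤ r) : ¬ IsLocalExtr (fun u => ‖γ u - γ s‖) t := by
  intro he
  have hd : HasDerivAt (fun u => ‖γ u - γ s‖ ^ 2) (2 * inner ℝ (γ t - γ s) (deriv γ t)) t :=
    ((h.hasDerivAt t).sub_const (γ s)).norm_sq
  have he2 : IsLocalExtr (fun u => ‖γ u - γ s‖ ^ 2) t := by
    rcases he with he | he
    · left; filter_upwards [he] with u hu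
      exact pow_le_pow_left₀ (norm_nonneg _) hu 2
    · right; filter_upwards [he] with u hu
      exact pow_le_pow_left₀ (norm_nonneg _) hu 2
  have := he2.hasDerivAt_eq_zero hd
  exact h.noncritical s t hne hle (by linarith)

/-- Take `m` to be a farthest point over one period. It is a local extremum, so its distance must
exceed `r`; the absence of low local minima then gives monotonicity on either side. -/
theorem exists_peak (h : NoncriticalCurve γ L r) (s : ℝ) : ∃ m, s < m ∧ m < s + L ∧
    r < ‖γ m - γ s‖ ∧
    (∀ x y, s ≤ x → x < y → y ≤ m → ‖γ x - γ s‖ ≤ r → ‖γ x - γ s‖ < ‖γ y - γ s‖) ∧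
    (∀ x y, m ≤ x → x < y → y ≤ s + L → ‖γ y - γ s‖ ≤ r → ‖γ y - γ s‖ < ‖γ x - γ s‖) := by
  have hL := h.length_pos
  have hc : Continuous fun u => ‖γ u - γ s‖ := (h.continuous.sub continuous_const).norm
  obtain ⟨m, hm, hmax⟩ := isCompact_Icc.exists_isMaxOn
    (Set.nonempty_Icc.2 (by linarith : s ≤ s + L)) (hc.continuousOn (s := Set.Icc s (s + L)))
  have hpos : ∀ t, s < t → t < s + L → 0 < ‖γ t - γ s‖ := fun t h1 h2 =>
    norm_pos_iff.2 (sub_ne_zero.2 (h.ne_of_lt s t h1 h2))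
  have hmid := hpos (s + L / 2) (by linarith) (by linarith)
  have hmm : 0 < ‖γ m - γ s‖ := hmid.trans_le (hmax ⟨by linarith, by linarith⟩)
  have h1 : s < m := lt_of_le_of_ne hm.1 (by rintro rfl; simp at hmm)
  have h2 : m < s + L := lt_of_le_of_ne hm.2 (by rintro rfl; simp [h.periodic s] at hmm)
  have h3 : r < ‖γ m - γ s‖ := by
    by_contra! hle
    refine h.not_isLocalExtr (h.ne_of_lt s m h1 h2) hle (Or.inr ?_)
    filter_upwards [Icc_mem_nhds h1 h2] with w hw using hmax hw
  refine ⟨m, h1, h2, h3, fun x y hx hxy hy hle => ?_, fun x y hx hxy hy hle => ?_⟩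
  · refine lt_of_forall_not_isLocalMin hc h3 (fun z hz hzr hmin => ?_) hx hxy hy hle
    exact h.not_isLocalExtr (h.ne_of_lt s z hz.1 (hz.2.trans h2)) hzr (Or.inl hmin)
  · have := lt_of_forall_not_isLocalMin (h := fun u => ‖γ (-u) - γ s‖) (a := -(s + L)) (m := -m)
      (M := r) (x := -y) (y := -x) (hc.comp continuous_neg) (by simpa using h3)
      (fun z hz hzr hmin => ?_) (by linarith) (by linarith) (by linarith) (by simpa using hle)
    · simpa using this
    · refine h.not_isLocalExtr (s := s) (t := -z)
        (h.ne_of_lt s (-z) (by linarith [hz.2]) (by linarith [hz.1])) hzr (Or.inl ?_)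
      have hmin2 : IsLocalMin ((fun u => ‖γ (-u) - γ s‖) ∘ fun u => -u) (-z) := by
        refine IsLocalMin.comp_continuous (by simpa using hmin) continuous_neg.continuousAt
      simp only [Function.comp_def, neg_neg] at hmin2
      exact hmin2

/-- An excursion beyond `r` before `t` would pass through distance exactly `r`, after which
monotonicity keeps the distance above `r`, also at `t`. -/
theorem staysClose_iff (h : NoncriticalCurve γ L r) {s m : ℝ} (h1 : s < m)
    (h3 : r < ‖γ m - γ s‖)
    (hmono : ∀ x y, s ≤ x → x < y → y ≤ m → ‖γ x - γ s‖ ≤ r → ‖γ x - γ s‖ < ‖γ y - γ s‖)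
    (t : ℝ) : StaysClose γ r s t ↔ s ≤ t ∧ t ≤ m ∧ ‖γ t - γ s‖ ≤ r := by
  constructor
  · rintro ⟨h4, h5⟩
    refine ⟨h4, ?_, h5 t ⟨h4, le_rfl⟩⟩
    by_contra! hlt
    linarith [h5 m ⟨h1.le, hlt.le⟩]
  · rintro ⟨h4, h5, h6⟩
    refine ⟨h4, fun u hu => ?_⟩
    by_contra! hlt
    rcases eq_or_lt_of_le hu.2 with rfl | h7
    · linarith
    have hc : Continuous fun u => ‖γ u - γ s‖ := (h.continuous.sub continuous_const).norm
    obtain ⟨v, hv, hvr⟩ := intermediate_value_Icc hu.1 hc.continuousOn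
      (show r ∈ Set.Icc ‖γ s - γ s‖ ‖γ u - γ s‖ from
        ⟨by simpa using h.radius_pos.le, hlt.le⟩)
    dsimp only at hvr
    linarith [hmono v t hv.1 (by linarith [hv.2]) h5 hvr.le]

theorem _root_.StaysClose.self (h : NoncriticalCurve γ L r) (s : ℝ) : StaysClose γ r s s := by
  refine ⟨le_rfl, fun u hu => ?_⟩
  rw [le_antisymm hu.2 hu.1]
  simpa using h.radius_pos.le

theorem _root_.StaysClose.lt_add (h : NoncriticalCurve γ L r) {s t : ℝ} (hst : StaysClose γ r s t) :
    t < s + L := by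
  obtain ⟨m, h1, h2, h3, hmono, -⟩ := h.exists_peak s
  exact (((h.staysClose_iff h1 h3 hmono t).1 hst).2.1).trans_lt h2

theorem _root_.StaysClose.mono {s t u : ℝ} (hst : StaysClose γ r s t) (h1 : s ≤ u) (h2 : u ≤ t) :
    StaysClose γ r s u :=
  ⟨h1, fun v hv => hst.2 v ⟨hv.1, hv.2.trans h2⟩⟩

theorem _root_.StaysClose.lt (h : NoncriticalCurve γ L r) {s x y : ℝ} (hst : StaysClose γ r s y)
    (hx : s ≤ x) (hxy : x < y) : ‖γ x - γ s‖ < ‖γ y - γ s‖ := by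
  obtain ⟨m, h1, h2, h3, hmono, -⟩ := h.exists_peak s
  have := (h.staysClose_iff h1 h3 hmono y).1 hst
  exact hmono x y hx hxy this.2.1 (hst.2 x ⟨hx, hxy.le⟩)

theorem _root_.StaysClose.eq (h : NoncriticalCurve γ L r) {s x y : ℝ} (hx : StaysClose γ r s x)
    (hy : StaysClose γ r s y) (hxy : ‖γ x - γ s‖ = ‖γ y - γ s‖) : x = y := by
  rcases lt_trichotomy x y with h1 | h1 | h1
  · exact absurd hxy (StaysClose.lt h hy hx.1 h1).ne
  · exact h1
  · exact absurd hxy (StaysClose.lt h hx hy.1 h1).ne'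

theorem exists_staysClose (h : NoncriticalCurve γ L r) (s : ℝ) {ρ : ℝ} (h0 : 0 ≤ ρ) (hρ : ρ ≤ r) :
    ∃ t, StaysClose γ r s t ∧ ‖γ t - γ s‖ = ρ := by
  obtain ⟨m, h1, h2, h3, hmono, -⟩ := h.exists_peak s
  have hc : Continuous fun u => ‖γ u - γ s‖ := (h.continuous.sub continuous_const).norm
  obtain ⟨v, hv, hvr⟩ := intermediate_value_Icc h1.le hc.continuousOn
      (show ρ ∈ Set.Icc ‖γ s - γ s‖ ‖γ m - γ s‖ from
        ⟨by simpa using h0, by linarith⟩)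
  dsimp only at hvr
  exact ⟨v, (h.staysClose_iff h1 h3 hmono v).2 ⟨hv.1, hv.2, hvr.trans_le hρ⟩, hvr⟩

/-- A point of the curve close to `γ s` lies on the forward or on the backward arc from `γ s`. -/
theorem exists_forward_or_backward (h : NoncriticalCurve γ L r) (s t : ℝ)
    (ht : ‖γ t - γ s‖ ≤ r) : ∃ u, γ u = γ t ∧
      (StaysClose γ r s u ∨ StaysClose (fun v => γ (-v)) r (-s) (-u)) := by
  obtain ⟨m, h1, h2, h3, hmono, hanti⟩ := h.exists_peak s
  obtain ⟨u, hu, hut⟩ := h.periodic.exists_mem_Ico h.length_pos t s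
  rw [hut] at ht
  rcases le_total u m with hum | hum
  · exact ⟨u, hut.symm, Or.inl ((h.staysClose_iff h1 h3 hmono u).2 ⟨hu.1, hum, ht⟩)⟩
  · refine ⟨u - L, by rw [h.periodic.sub_eq, hut], Or.inr ?_⟩
    have hsh : ∀ v, γ (L + v) = γ v := fun v => by rw [add_comm, h.periodic v]
    refine (h.reverse.staysClose_iff (s := -s) (m := -(m - L)) (by linarith) ?_ ?_ _).2
      ⟨by linarith [hu.2], by linarith, ?_⟩
    · simpa [h.periodic.sub_eq] using h3
    · intro x y hx hxy hy hle
      have := hanti (L - y) (L - x) (by linarith) (by linarith) (by linarith)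
      simp only [sub_eq_add_neg, hsh, neg_neg] at this hle ⊢
      exact this hle
    · simpa [h.periodic.sub_eq] using ht

/-- The inner product starts with derivative `1` at `s` and cannot return to zero, by noncriticality
with the roles of the endpoints exchanged: the disk is centred at the later point. -/
theorem _root_.StaysClose.inner_pos (h : NoncriticalCurve γ L r) {s t : ℝ} (hst : StaysClose γ r s t)
    (hlt : s < t) : 0 < inner ℝ (γ t - γ s) (deriv γ s) := by
  have hne : ∀ u ∈ Set.Ioc s t, inner ℝ (γ u - γ s) (deriv γ s) ≠ 0 := by
    intro u hu h0
    refine h.noncritical u s ?_ ?_ ?_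
    · exact (h.ne_of_lt s u hu.1 (hu.2.trans_lt (StaysClose.lt_add h hst))).symm
    · rw [norm_sub_rev]; exact hst.2 u ⟨hu.1.le, hu.2⟩
    · rw [← neg_sub, inner_neg_left, h0, neg_zero]
  have hd : HasDerivAt (fun u => inner ℝ (γ u - γ s) (deriv γ s)) 1 s := by
    have := ((h.hasDerivAt s).sub_const (γ s)).inner ℝ (hasDerivAt_const s (deriv γ s))
    simpa [h.unit_speed] using this
  have hev : ∀ᶠ u in 𝓝[>] s, 0 < inner ℝ (γ u - γ s) (deriv γ s) := by
    have h1 := (hasDerivAt_iff_tendsto_slope.1 hd).mono_left (nhdsGT_le_nhdsNE s)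
    filter_upwards [h1.eventually (lt_mem_nhds zero_lt_one), self_mem_nhdsWithin] with u hu hus
    have hus' : 0 < u - s := sub_pos.2 hus
    simp only [slope_def_field, sub_self, inner_zero_left, sub_zero] at hu
    exact (div_pos_iff_of_pos_right hus').1 hu
  obtain ⟨u, hu, hut⟩ := (hev.and (Ioo_mem_nhdsGT hlt)).exists
  by_contra! hle
  have hc : Continuous fun u => inner ℝ (γ u - γ s) (deriv γ s) := by
    have := h.continuous
    fun_prop
  obtain ⟨v, hv, hv0⟩ := intermediate_value_Icc' hut.2.le hc.continuousOn
    (show (0 : ℝ) ∈ Set.Icc _ _ from ⟨hle, hu.le⟩)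
  exact hne v ⟨hut.1.trans_le hv.1, hv.2⟩ hv0

/-- Suppose the arc, seen from `γ t`, leaves the disk at time `v`. By `StaysClose.inner_pos` the
distance to `γ t` decreases strictly just after `s`, so its minimum over `[s, v]` is interior and at
most `r`, hence a forbidden critical point. -/
theorem _root_.StaysClose.reverse (h : NoncriticalCurve γ L r) {s t : ℝ} (hst : StaysClose γ r s t) :
    StaysClose (fun v => γ (-v)) r (-t) (-s) := by
  refine ⟨neg_le_neg hst.1, fun u hu => ?_⟩
  simp only [neg_neg]
  by_contra! hlt
  set v := -u with hv
  have hsv : s ≤ v := by linarith [hu.2]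
  have hvt : v ≤ t := by linarith [hu.1]
  have hs : ‖γ s - γ t‖ ≤ r := by rw [norm_sub_rev]; exact hst.2 t ⟨hst.1, le_rfl⟩
  have hsv' : s < v := lt_of_le_of_ne hsv (by intro h1; rw [← h1] at hlt; linarith)
  have hc : Continuous fun u => ‖γ u - γ t‖ := (h.continuous.sub continuous_const).norm
  obtain ⟨z, hz, hmin⟩ := isCompact_Icc.exists_isMinOn
    (Set.nonempty_Icc.2 hsv) (hc.continuousOn (s := Set.Icc s v))
  have hmin' : ∀ w ∈ Set.Icc s v, ‖γ z - γ t‖ ≤ ‖γ w - γ t‖ := fun w hw => hmin hw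
  have hzs : ‖γ z - γ t‖ ≤ ‖γ s - γ t‖ := hmin' s ⟨le_rfl, hsv⟩
  have hzv : z < v := lt_of_le_of_ne hz.2 (by intro h1; rw [h1] at hzs; linarith)
  have htL := StaysClose.lt_add h hst
  have hsz : s < z := by
    refine lt_of_le_of_ne hz.1 (fun h1 => ?_)
    subst h1
    have hd : HasDerivAt (fun u => ‖γ u - γ t‖ ^ 2) (2 * inner ℝ (γ s - γ t) (deriv γ s)) s :=
      ((h.hasDerivAt s).sub_const (γ t)).norm_sq
    have hneg : 2 * inner ℝ (γ s - γ t) (deriv γ s) < 0 := by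
      have := StaysClose.inner_pos h hst (hsv'.trans_le hvt)
      rw [← neg_sub, inner_neg_left]; linarith
    have h1 := (hasDerivAt_iff_tendsto_slope.1 hd).mono_left (nhdsGT_le_nhdsNE s)
    obtain ⟨w, hw, hws⟩ :=
      ((h1.eventually (gt_mem_nhds hneg)).and (Ioo_mem_nhdsGT hsv')).exists
    have hws' : 0 < w - s := sub_pos.2 hws.1
    rw [slope_def_field, div_lt_iff₀ hws', zero_mul] at hw
    have := pow_le_pow_left₀ (norm_nonneg _) (hmin' w ⟨hws.1.le, hws.2.le⟩) 2
    linarith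
  refine h.not_isLocalExtr (h.ne_of_lt z t (hzv.trans_le hvt) (by linarith)).symm
    (hzs.trans hs) (Or.inl ?_)
  filter_upwards [Icc_mem_nhds hsz hzv] with w hw using hmin' w hw

/-! ### Exit times. -/

/-- The exit time of the forward arc from `γ s` out of the disk of radius `ρ`. -/
noncomputable def _root_.exitTime (γ : ℝ → ℂ) (r s ρ : ℝ) : ℝ :=
  Classical.epsilon fun t => StaysClose γ r s t ∧ ‖γ t - γ s‖ = ρ

theorem exitTime_spec (h : NoncriticalCurve γ L r) (s : ℝ) {ρ : ℝ} (h0 : 0 ≤ ρ) (hρ : ρ ≤ r) :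
    StaysClose γ r s (exitTime γ r s ρ) ∧ ‖γ (exitTime γ r s ρ) - γ s‖ = ρ :=
  Classical.epsilon_spec (h.exists_staysClose s h0 hρ)

theorem _root_.StaysClose.exitTime_eq (h : NoncriticalCurve γ L r) {s t : ℝ}
    (hst : StaysClose γ r s t) : exitTime γ r s ‖γ t - γ s‖ = t := by
  have := h.exitTime_spec s (norm_nonneg (γ t - γ s)) (hst.2 t ⟨hst.1, le_rfl⟩)
  exact StaysClose.eq h this.1 hst this.2

/-- A chord is no longer than its arc. This bound makes every step of the reconstruction advance by
at least `r`. -/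
theorem add_le_exitTime (h : NoncriticalCurve γ L r) (s : ℝ) {ρ : ℝ} (h0 : 0 ≤ ρ) (hρ : ρ ≤ r) :
    s + ρ ≤ exitTime γ r s ρ := by
  have h1 := h.exitTime_spec s h0 hρ
  have h2 := h.norm_sub_le s (exitTime γ r s ρ)
  rw [h1.2, abs_of_nonneg (sub_nonneg.2 h1.1.1)] at h2
  linarith

theorem exitTime_zero (h : NoncriticalCurve γ L r) (s : ℝ) : exitTime γ r s 0 = s := by
  simpa using StaysClose.exitTime_eq h (StaysClose.self h s)

theorem exitTime_radius_lt (h : NoncriticalCurve γ L r) (s : ℝ) {ρ ρ' : ℝ} (h0 : 0 ≤ ρ)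
    (hlt : ρ < ρ') (hρ : ρ' ≤ r) : exitTime γ r s ρ < exitTime γ r s ρ' := by
  have h1 := h.exitTime_spec s h0 (hlt.le.trans hρ)
  have h2 := h.exitTime_spec s (h0.trans hlt.le) hρ
  by_contra! hle
  rcases eq_or_lt_of_le hle with h3 | h3
  · rw [← h3, h2.2] at h1; linarith [h1.2]
  · have := StaysClose.lt h h1.1 h2.1.1 h3
    rw [h1.2, h2.2] at this; linarith

/-- Otherwise the arc from `s` contains the later start `s'` and its exit time `t'`. Going back from
`t'`, the distance grows strictly, so `γ s` is farther from `γ t'` than `γ s'` is, that is, farther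
than `r`. -/
theorem exitTime_strictMono (h : NoncriticalCurve γ L r) :
    StrictMono fun s => exitTime γ r s r := by
  intro s s' hs
  have h1 := h.exitTime_spec s h.radius_pos.le le_rfl
  have h2 := h.exitTime_spec s' h.radius_pos.le le_rfl
  dsimp only
  set t := exitTime γ r s r
  set t' := exitTime γ r s' r
  by_contra! hle
  have h3 := StaysClose.reverse h (h1.1.mono (hs.le.trans h2.1.1) hle)
  have h4 := StaysClose.lt h.reverse h3 (neg_le_neg h2.1.1) (neg_lt_neg hs)
  simp only [neg_neg] at h4
  rw [norm_sub_rev, h2.2] at h4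
  have h5 := h1.1.2 t' ⟨hs.le.trans h2.1.1, hle⟩
  rw [norm_sub_rev] at h5
  linarith

theorem exitTime_surjective (h : NoncriticalCurve γ L r) :
    Function.Surjective fun s => exitTime γ r s r := by
  intro t
  obtain ⟨u, hu, hur⟩ := h.reverse.exists_staysClose (-t) h.radius_pos.le le_rfl
  have h1 := StaysClose.reverse h.reverse hu
  simp only [neg_neg] at h1 hur
  refine ⟨-u, ?_⟩
  have h2 := StaysClose.exitTime_eq h h1
  rwa [norm_sub_rev, hur] at h2

end NoncriticalCurve

/-! ### Arclength as variation. -/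

theorem eVariationOn_Icc_of_norm_deriv_eq_one {γ : ℝ → ℂ} (hd : Differentiable ℝ γ)
    (hu : ∀ s, ‖deriv γ s‖ = 1) {a b : ℝ} (hab : a ≤ b) :
    eVariationOn γ (Set.Icc a b) = ENNReal.ofReal (b - a) := by
  have hlip : LipschitzWith 1 γ :=
    lipschitzWith_of_nnnorm_deriv_le hd fun x => by
      rw [← NNReal.coe_le_coe]; simpa using (hu x).le
  have hub : ∀ x y, x ≤ y → eVariationOn γ (Set.Icc x y) ≤ ENNReal.ofReal (y - x) := by
    intro x y hxy
    have h1 := (hlip.lipschitzOnWith (s := Set.univ)).comp_eVariationOn_le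
      (g := id) (s := Set.Icc x y) (Set.mapsTo_univ _ _)
    have h2 := (monotone_id.monotoneOn (Set.univ : Set ℝ)).eVariationOn_eq
      (Set.mem_univ x) (Set.mem_univ y)
    simp only [Set.univ_inter, id] at h2
    simpa [h2] using h1
  have hbv : LocallyBoundedVariationOn γ Set.univ := fun x y _ _ => by
    rcases le_total x y with hxy | hxy
    · rw [Set.univ_inter]
      exact ne_top_of_le_ne_top ENNReal.ofReal_ne_top (hub x y hxy)
    · have : (Set.univ ∩ Set.Icc x y).Subsingleton := by
        rw [Set.univ_inter]; exact Set.subsingleton_Icc_of_ge hxy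
      change eVariationOn γ (Set.univ ∩ Set.Icc x y) ≠ ⊤
      rw [eVariationOn.subsingleton _ this]; simp
  set V : ℝ → ℝ := variationOnFromTo γ Set.univ a with hV
  have hle : ∀ x y, x ≤ y → V y - V x ≤ y - x ∧ ‖γ y - γ x‖ ≤ V y - V x := by
    intro x y hxy
    have h1 : V y - V x = (eVariationOn γ (Set.Icc x y)).toReal := by
      have h0 := variationOnFromTo.add hbv (Set.mem_univ a) (Set.mem_univ x) (Set.mem_univ y)
      rw [variationOnFromTo.eq_of_le _ _ hxy, Set.univ_inter] at h0
      exact sub_eq_of_eq_add' h0.symm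
    rw [h1]
    refine ⟨ENNReal.toReal_le_of_le_ofReal (by linarith) (hub x y hxy), ?_⟩
    have h2 := eVariationOn.edist_le γ (s := Set.Icc x y) (x := y) (y := x)
      ⟨hxy, le_rfl⟩ ⟨le_rfl, hxy⟩
    have h3 := ENNReal.toReal_mono
      (ne_top_of_le_ne_top ENNReal.ofReal_ne_top (hub x y hxy)) h2
    rwa [edist_dist, ENNReal.toReal_ofReal dist_nonneg, dist_eq_norm] at h3
  -- The variation lies between chord and parameter length. Their gap is `o(y - x)` at unit speed,
  -- so `V` has derivative `1`.
  have habs : ∀ x y, |V y - V x - (y - x)| ≤ ‖‖y - x‖ - ‖γ y - γ x‖‖ := by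
    intro x y
    refine le_trans ?_ (le_abs_self _)
    rcases le_total x y with hxy | hxy
    · have := hle x y hxy
      rw [Real.norm_eq_abs, abs_of_nonneg (sub_nonneg.2 hxy), abs_le]
      constructor <;> linarith
    · have := hle y x hxy
      rw [norm_sub_rev (γ y), Real.norm_eq_abs, abs_of_nonpos (sub_nonpos.2 hxy), abs_le]
      constructor <;> linarith
  have hder : ∀ x, HasDerivAt V 1 x := by
    intro x
    rw [hasDerivAt_iff_isLittleO]
    have h1 := hasDerivAt_iff_isLittleO.1 (hd x).hasDerivAt
    refine Asymptotics.IsBigO.trans_isLittleO (Asymptotics.IsBigO.of_bound 1 ?_) h1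
    filter_upwards with y
    rw [one_mul, smul_eq_mul, mul_one, Real.norm_eq_abs]
    refine (habs x y).trans ?_
    have h2 : ‖y - x‖ = ‖(y - x) • deriv γ x‖ := by rw [norm_smul, hu, mul_one]
    rw [h2, norm_sub_rev (γ y - γ x)]
    exact abs_norm_sub_norm_le _ _
  have hconst := is_const_of_deriv_eq_zero (f := fun x => V x - x)
    (fun x => ((hder x).sub (hasDerivAt_id x)).differentiableAt)
    (fun x => (((hder x).sub (hasDerivAt_id x)).congr_deriv (sub_self 1)).deriv) a b
  have h1 : V b - V a = (eVariationOn γ (Set.Icc a b)).toReal := by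
    have h2 : V a = 0 := variationOnFromTo.self _ _ _
    rw [h2, sub_zero, hV, variationOnFromTo.eq_of_le _ _ hab, Set.univ_inter]
  have h2 : (eVariationOn γ (Set.Icc a b)).toReal = b - a := by
    linarith
  rw [← h2, ENNReal.ofReal_toReal]
  exact ne_top_of_le_ne_top ENNReal.ofReal_ne_top (hub a b hab)

/-- Two monotone parametrizations of the same curve with respect to arclength that start at the
same time agree. -/
theorem eq_of_unitSpeed_comp_eq {γ₁ γ₂ : ℝ → ℂ} (hd₁ : Differentiable ℝ γ₁)
    (hu₁ : ∀ s, ‖deriv γ₁ s‖ = 1) (hd₂ : Differentiable ℝ γ₂) (hu₂ : ∀ s, ‖deriv γ₂ s‖ = 1)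
    {A B : ℂ} (hA : ‖A‖ = 1) {t₁ t₂ : ℝ → ℝ} {a b : ℝ} (hab : a ≤ b)
    (hm₁ : MonotoneOn t₁ (Set.Icc a b)) (hm₂ : MonotoneOn t₂ (Set.Icc a b))
    (hs₁ : Set.SurjOn t₁ (Set.Icc a b) (Set.Icc (t₁ a) (t₁ b)))
    (hs₂ : Set.SurjOn t₂ (Set.Icc a b) (Set.Icc (t₂ a) (t₂ b)))
    (heq : ∀ x ∈ Set.Icc a b, γ₂ (t₂ x) = A * γ₁ (t₁ x) + B) (h0 : t₁ a = t₂ a) :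
    t₁ b = t₂ b := by
  have ha : a ∈ Set.Icc a b := ⟨le_rfl, hab⟩
  have hb : b ∈ Set.Icc a b := ⟨hab, le_rfl⟩
  have himg : ∀ {t : ℝ → ℝ}, MonotoneOn t (Set.Icc a b) →
      Set.SurjOn t (Set.Icc a b) (Set.Icc (t a) (t b)) →
      t '' Set.Icc a b = Set.Icc (t a) (t b) := by
    intro t hm hs
    refine Set.Subset.antisymm ?_ hs
    rintro _ ⟨x, hx, rfl⟩
    exact ⟨hm ha hx hx.1, hm hx hb hx.2⟩
  have hd₃ : Differentiable ℝ fun s => A * γ₁ s + B := (hd₁.const_mul A).add_const B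
  have hu₃ : ∀ s, ‖deriv (fun s => A * γ₁ s + B) s‖ = 1 := fun s => by
    rw [(((hd₁ s).hasDerivAt.const_mul A).add_const B).deriv, norm_mul, hA, hu₁, mul_one]
  have h1 := eVariationOn.comp_eq_of_monotoneOn (fun s => A * γ₁ s + B) t₁ hm₁
  have h2 := eVariationOn.comp_eq_of_monotoneOn γ₂ t₂ hm₂
  have h3 : eVariationOn ((fun s => A * γ₁ s + B) ∘ t₁) (Set.Icc a b) =
      eVariationOn (γ₂ ∘ t₂) (Set.Icc a b) :=
    eVariationOn.congr fun x hx => (heq x hx).symm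
  have l1 := hm₁ ha hb hab
  have l2 := hm₂ ha hb hab
  rw [h1, h2, himg hm₁ hs₁, himg hm₂ hs₂, eVariationOn_Icc_of_norm_deriv_eq_one hd₃ hu₃ l1,
    eVariationOn_Icc_of_norm_deriv_eq_one hd₂ hu₂ l2] at h3
  have h4 := congrArg ENNReal.toReal h3
  rw [ENNReal.toReal_ofReal (by linarith), ENNReal.toReal_ofReal (by linarith)] at h4
  linarith

theorem NoncriticalCurve.differentiable {γ : ℝ → ℂ} {L r : ℝ} (h : NoncriticalCurve γ L r) :
    Differentiable ℝ γ := h.contDiff.differentiable one_ne_zero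

theorem NoncriticalCurve.deriv_ne_zero {γ : ℝ → ℂ} {L r : ℝ} (h : NoncriticalCurve γ L r)
    (s : ℝ) : deriv γ s ≠ 0 := norm_pos_iff.1 (by rw [h.unit_speed]; exact one_pos)

/-! ### Reconstruction of the curve from its exit points. -/

/-- The exit point of the forward arc, in the frame given by the position and the tangent. -/
noncomputable def exitPoint (γ : ℝ → ℂ) (r s ρ : ℝ) : ℂ :=
  (γ (exitTime γ r s ρ) - γ s) / deriv γ s

theorem NoncriticalCurve.congr_exitPoint {γ₁ γ₂ : ℝ → ℂ} {L r : ℝ}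
    (h₁ : NoncriticalCurve γ₁ L r) (h₂ : NoncriticalCurve γ₂ L r) {A B : ℂ} {s ρ : ℝ}
    (hγ : γ₂ s = A * γ₁ s + B) (hγ' : deriv γ₂ s = A * deriv γ₁ s)
    (he : exitPoint γ₁ r s ρ = exitPoint γ₂ r s ρ) :
    γ₂ (exitTime γ₂ r s ρ) = A * γ₁ (exitTime γ₁ r s ρ) + B := by
  unfold exitPoint at he
  have := h₁.deriv_ne_zero s
  have := h₂.deriv_ne_zero s
  rw [div_eq_div_iff (h₁.deriv_ne_zero s) (h₂.deriv_ne_zero s), hγ', hγ] at he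
  have h3 : deriv γ₁ s * (γ₂ (exitTime γ₂ r s ρ) - (A * γ₁ (exitTime γ₁ r s ρ) + B)) = 0 := by
    linear_combination -he
  exact sub_eq_zero.1 ((mul_eq_zero.1 h3).resolve_left (h₁.deriv_ne_zero s))

theorem NoncriticalCurve.congr_of_exitPoint_eq {γ₁ γ₂ : ℝ → ℂ} {L r : ℝ}
    (h₁ : NoncriticalCurve γ₁ L r) (h₂ : NoncriticalCurve γ₂ L r) (s₀ : ℝ)
    (hr : ∀ s, exitPoint γ₁ r s r = exitPoint γ₂ r s r)
    (hs₀ : ∀ ρ ∈ Set.Ioc 0 r, exitPoint γ₁ r s₀ ρ = exitPoint γ₂ r s₀ ρ) :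
    ∃ A B : ℂ, ‖A‖ = 1 ∧ ∀ s, γ₂ s = A * γ₁ s + B := by
  have hr0 := h₁.radius_pos
  -- The rigid motion is forced: it matches positions and unit tangents at `s₀`.
  set A := deriv γ₂ s₀ / deriv γ₁ s₀ with hA
  set B := γ₂ s₀ - A * γ₁ s₀ with hB
  have hA1 : ‖A‖ = 1 := by rw [hA, norm_div, h₁.unit_speed, h₂.unit_speed, div_one]
  have hd0 : deriv γ₂ s₀ = A * deriv γ₁ s₀ := by
    rw [hA, div_mul_cancel₀ _ (h₁.deriv_ne_zero s₀)]
  have h0 : γ₂ s₀ = A * γ₁ s₀ + B := by rw [hB]; ring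
  have exit0 : ∀ ρ ∈ Set.Icc 0 r,
      γ₂ (exitTime γ₂ r s₀ ρ) = A * γ₁ (exitTime γ₁ r s₀ ρ) + B := by
    intro ρ hρ
    rcases eq_or_lt_of_le hρ.1 with h | h
    · rw [← h, h₁.exitTime_zero, h₂.exitTime_zero, h0]
    · exact h₁.congr_exitPoint h₂ h0 hd0 (hs₀ ρ ⟨h, hρ.2⟩)
  have hmono : ∀ {γ : ℝ → ℂ}, NoncriticalCurve γ L r →
      StrictMonoOn (exitTime γ r s₀) (Set.Icc 0 r) := fun h x hx y hy hxy =>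
    h.exitTime_radius_lt s₀ hx.1 hxy hy.2
  have hsurj : ∀ {γ : ℝ → ℂ}, NoncriticalCurve γ L r → ∀ ρ ∈ Set.Icc 0 r,
      Set.SurjOn (exitTime γ r s₀) (Set.Icc 0 ρ)
        (Set.Icc (exitTime γ r s₀ 0) (exitTime γ r s₀ ρ)) := by
    intro γ h ρ hρ t ht
    rw [h.exitTime_zero] at ht
    have h1 := h.exitTime_spec s₀ hρ.1 hρ.2
    have h2 := h1.1.mono ht.1 ht.2
    have h3 : ‖γ t - γ s₀‖ ≤ r := h2.2 t ⟨ht.1, le_rfl⟩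
    have h4 := h2.exitTime_eq h
    refine ⟨‖γ t - γ s₀‖, ⟨norm_nonneg _, ?_⟩, h4⟩
    exact ((hmono h).le_iff_le ⟨norm_nonneg _, h3⟩ hρ).1 (h4.trans_le ht.2)
  have time0 : ∀ ρ ∈ Set.Icc 0 r, exitTime γ₁ r s₀ ρ = exitTime γ₂ r s₀ ρ := by
    intro ρ hρ
    have hsub : Set.Icc 0 ρ ⊆ Set.Icc 0 r := Set.Icc_subset_Icc_right hρ.2
    exact eq_of_unitSpeed_comp_eq h₁.differentiable h₁.unit_speed h₂.differentiable
      h₂.unit_speed hA1 hρ.1 ((hmono h₁).monotoneOn.mono hsub)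
      ((hmono h₂).monotoneOn.mono hsub) (hsurj h₁ ρ hρ) (hsurj h₂ ρ hρ)
      (fun x hx => exit0 x (hsub hx)) (by rw [h₁.exitTime_zero, h₂.exitTime_zero])
  have first : ∀ t ∈ Set.Icc s₀ (exitTime γ₁ r s₀ r), γ₂ t = A * γ₁ t + B := by
    intro t ht
    have hrr : r ∈ Set.Icc 0 r := ⟨hr0.le, le_rfl⟩
    obtain ⟨ρ, hρ, rfl⟩ := hsurj h₁ r hrr (by rwa [h₁.exitTime_zero])
    rw [← exit0 ρ hρ, time0 ρ hρ]
  have step : ∀ n : ℕ, ∀ t ∈ Set.Icc s₀ (s₀ + (n + 1) * r), γ₂ t = A * γ₁ t + B := by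
    intro n
    induction n with
    | zero =>
      intro t ht
      refine first t ⟨ht.1, ht.2.trans ?_⟩
      have := h₁.add_le_exitTime s₀ hr0.le le_rfl
      simpa using this
    | succ n ih =>
      intro t ht
      have hpos : 0 < ((n : ℝ) + 1) * r := by positivity
      set s₁ := s₀ + ((n : ℝ) + 1) * r with hs₁
      have hlt : s₀ < s₁ := by linarith
      have hder : ∀ s ∈ Set.Icc s₀ s₁, deriv γ₂ s = A * deriv γ₁ s := by
        intro s hs
        -- Agreement is known only on the closed interval, so tangents are compared through
        -- derivatives within it, which covers the endpoints.
        have e1 : HasDerivWithinAt γ₂ (deriv γ₂ s) (Set.Icc s₀ s₁) s :=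
          (h₂.hasDerivAt s).hasDerivWithinAt
        have e2 : HasDerivWithinAt γ₂ (A * deriv γ₁ s) (Set.Icc s₀ s₁) s :=
          (((h₁.hasDerivAt s).const_mul A).add_const B).hasDerivWithinAt.congr
            (fun x hx => ih x hx) (ih s hs)
        exact (uniqueDiffOn_Icc hlt s hs).eq_deriv _ e1 e2
      have exit1 : ∀ s ∈ Set.Icc s₀ s₁,
          γ₂ (exitTime γ₂ r s r) = A * γ₁ (exitTime γ₁ r s r) + B := fun s hs =>
        h₁.congr_exitPoint h₂ (ih s hs) (hder s hs) (hr s)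
      have hsurj' : ∀ {γ : ℝ → ℂ}, NoncriticalCurve γ L r → ∀ s,
          Set.SurjOn (fun s => exitTime γ r s r) (Set.Icc s₀ s)
            (Set.Icc (exitTime γ r s₀ r) (exitTime γ r s r)) := by
        intro γ h s t ht
        obtain ⟨u, rfl⟩ := h.exitTime_surjective t
        exact ⟨u, ⟨h.exitTime_strictMono.le_iff_le.1 ht.1,
          h.exitTime_strictMono.le_iff_le.1 ht.2⟩, rfl⟩
      have time1 : ∀ s ∈ Set.Icc s₀ s₁, exitTime γ₁ r s r = exitTime γ₂ r s r := by
        intro s hs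
        exact eq_of_unitSpeed_comp_eq (t₁ := fun s => exitTime γ₁ r s r)
          (t₂ := fun s => exitTime γ₂ r s r) h₁.differentiable h₁.unit_speed h₂.differentiable
          h₂.unit_speed hA1 hs.1 (h₁.exitTime_strictMono.monotone.monotoneOn _)
          (h₂.exitTime_strictMono.monotone.monotoneOn _) (hsurj' h₁ s) (hsurj' h₂ s)
          (fun x hx => exit1 x ⟨hx.1, hx.2.trans hs.2⟩) (time0 r ⟨hr0.le, le_rfl⟩)
      -- Beyond the initial arc, `t` is the exit time of some start in `[s₀, s₁]`, because the exit
      -- time of `s₁` is at least `s₁ + r`.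
      rcases le_total t (exitTime γ₁ r s₀ r) with hle | hle
      · exact first t ⟨ht.1, hle⟩
      · have h3 := h₁.add_le_exitTime s₁ hr0.le le_rfl
        have h4 : t ≤ exitTime γ₁ r s₁ r := by
          refine ht.2.trans (le_trans (le_of_eq ?_) h3)
          rw [hs₁]; push_cast; ring
        obtain ⟨s, hs, rfl⟩ := hsurj' h₁ s₁ ⟨hle, h4⟩
        dsimp only
        rw [← exit1 s hs, time1 s hs]
  refine ⟨A, B, hA1, fun s => ?_⟩
  have hper : Function.Periodic (fun s => γ₂ s - (A * γ₁ s + B)) L := fun s => by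
    simp only [h₁.periodic s, h₂.periodic s]
  obtain ⟨u, hu, hsu⟩ := hper.exists_mem_Ico h₁.length_pos s s₀
  obtain ⟨n, hn⟩ := exists_nat_ge (L / r)
  rw [div_le_iff₀ hr0] at hn
  have := step n u ⟨hu.1, by linarith [hu.2]⟩
  rw [this, sub_self] at hsu
  exact sub_eq_zero.1 hsu

/-! ### From tangentially graph-like boundaries to noncritical curves. -/

namespace IsC1Shape

variable {Ω : Set ℂ} {L : ℝ} {γ : ℝ → ℂ}

theorem hasDerivAt (h : IsC1Shape Ω L γ) (t : ℝ) : HasDerivAt γ (deriv γ t) t :=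
  (h.contDiff.differentiable one_ne_zero t).hasDerivAt

theorem range_eq (h : IsC1Shape Ω L γ) : Set.range γ = frontier Ω := by
  rw [← h.image_eq]
  refine Set.Subset.antisymm ?_ (Set.image_subset_range _ _)
  rintro _ ⟨t, rfl⟩
  obtain ⟨u, hu, hut⟩ := h.periodic.exists_mem_Ico₀ h.length_pos t
  exact ⟨u, hu, hut.symm⟩

theorem mem_frontier (h : IsC1Shape Ω L γ) (t : ℝ) : γ t ∈ frontier Ω :=
  h.range_eq ▸ Set.mem_range_self t

theorem ne_of_lt (h : IsC1Shape Ω L γ) (s t : ℝ) (h1 : s < t) (h2 : t < s + L) :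
    γ t ≠ γ s := by
  intro heq
  have hL := h.length_pos
  obtain ⟨m, hm, -⟩ := existsUnique_add_zsmul_mem_Ico hL s 0
  obtain ⟨n, hn, -⟩ := existsUnique_add_zsmul_mem_Ico hL t 0
  rw [zero_add] at hm hn
  have h3 := h.injOn hn hm (by rw [h.periodic.zsmul n t, h.periodic.zsmul m s, heq])
  simp only [zsmul_eq_mul] at h3
  have h4 : t - s = ((m - n : ℤ) : ℝ) * L := by push_cast; linarith
  have h5 : (0 : ℝ) < ((m - n : ℤ) : ℝ) := by
    by_contra! hle
    nlinarith
  have h6 : ((m - n : ℤ) : ℝ) < 1 := by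
    by_contra! hle
    nlinarith
  have h5' : 0 < m - n := by exact_mod_cast h5
  have h6' : m - n < 1 := by exact_mod_cast h6
  omega

theorem inner_ne_zero_of_isTGL (h : IsC1Shape Ω L γ) {r : ℝ} (hr : 0 < r)
    (htgl : IsTGL (frontier Ω) r) (s t : ℝ) (hne : γ t ≠ γ s) (hle : ‖γ t - γ s‖ ≤ r) :
    inner ℝ (γ t - γ s) (deriv γ t) ≠ 0 := by
  obtain ⟨u, A, f, hu, -, hf0, hf', hC⟩ := htgl (γ t) (h.mem_frontier t)
  have hu0 : u ≠ 0 := norm_pos_iff.1 (by rw [hu]; exact one_pos)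
  have hmem : ∀ v, ‖γ v - γ t‖ ≤ r → ∃ x : ℝ, (γ v - γ t) / u = x + f x * Complex.I := by
    intro v hv
    have h1 : γ v ∈ frontier Ω ∩ Metric.closedBall (γ t) r :=
      ⟨h.mem_frontier v, by rwa [mem_closedBall_iff_norm]⟩
    rw [hC] at h1
    obtain ⟨x, -, hx⟩ := h1
    refine ⟨x, ?_⟩
    rw [← hx]
    field_simp
    ring
  have hg : HasDerivAt (fun v => (γ v - γ t) / u) (deriv γ t / u) t :=
    ((h.hasDerivAt t).sub_const (γ t)).div_const u
  have hre : HasDerivAt (fun v => ((γ v - γ t) / u).re) (deriv γ t / u).re t :=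
    Complex.reCLM.hasFDerivAt.comp_hasDerivAt t hg
  have him : HasDerivAt (fun v => ((γ v - γ t) / u).im) (deriv γ t / u).im t :=
    Complex.imCLM.hasFDerivAt.comp_hasDerivAt t hg
  have hcomp : HasDerivAt (fun v => f ((γ v - γ t) / u).re) (0 * (deriv γ t / u).re) t := by
    refine HasDerivAt.comp (h₂ := f) t ?_ hre
    simpa using hf'
  -- Differentiating this graph equation, with `f' 0 = 0`, shows that the tangent at `γ t` points
  -- along the axis `u`.
  have hev : (fun v => ((γ v - γ t) / u).im) =ᶠ[𝓝 t] fun v => f ((γ v - γ t) / u).re := by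
    have hc : Filter.Tendsto (fun v => ‖γ v - γ t‖) (𝓝 t) (𝓝 0) := by
      have := ((h.contDiff.continuous.sub continuous_const).norm :
        Continuous fun v => ‖γ v - γ t‖).tendsto t
      simpa using this
    filter_upwards [hc.eventually (ge_mem_nhds hr)] with v hv
    obtain ⟨x, hx⟩ := hmem v hv
    rw [hx]
    simp
  have him0 : (deriv γ t / u).im = 0 := by
    rw [(hcomp.congr_of_eventuallyEq hev).unique him |>.symm, zero_mul]
  obtain ⟨x, hx⟩ := hmem s (by rwa [norm_sub_rev])
  intro hinner
  have hd : deriv γ t = ((deriv γ t / u).re : ℂ) * u := by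
    have : deriv γ t / u = ((deriv γ t / u).re : ℂ) := Complex.ext rfl (by simpa using him0)
    rw [← this, div_mul_cancel₀ _ hu0]
  set c := (deriv γ t / u).re with hc
  have hc0 : c ≠ 0 := by
    intro h0
    have := h.unit_speed t
    rw [hd, h0] at this
    simp at this
  have hx' : γ s - γ t = (x + f x * Complex.I) * u := by rw [← hx, div_mul_cancel₀ _ hu0]
  -- Orthogonality to the tangent puts `γ s` on the normal axis, where the graph has only the point
  -- with `f 0 = 0`.
  have hx0 : x = 0 := by
    rw [← neg_sub, inner_neg_left, neg_eq_zero, hx', hd, Complex.inner] at hinner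
    have e : (c * u) * (starRingEnd ℂ) ((x + f x * Complex.I) * u) =
        (x - f x * Complex.I) * c * (u * (starRingEnd ℂ) u) := by
      simp only [map_mul, map_add, Complex.conj_ofReal, Complex.conj_I]
      ring
    rw [e, Complex.mul_conj, Complex.normSq_eq_norm_sq, hu] at hinner
    simp at hinner
    exact hinner.resolve_right hc0
  rw [hx0, hf0] at hx'
  apply hne
  simp at hx'
  exact (sub_eq_zero.1 hx').symm

theorem noncriticalCurve (h : IsC1Shape Ω L γ) {r : ℝ} (hr : 0 < r)
    (htgl : IsTGL (frontier Ω) r) : NoncriticalCurve γ L r where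
  contDiff := h.contDiff
  length_pos := h.length_pos
  radius_pos := hr
  unit_speed := h.unit_speed
  periodic := h.periodic
  ne_of_lt := h.ne_of_lt
  noncritical := h.inner_ne_zero_of_isTGL hr htgl

end IsC1Shape

/-! ### The regions above and below the forward arc. -/

theorem IsPreconnected.subset_interior_or_subset_compl_closure {X : Type*} [TopologicalSpace X]
    {S Ω : Set X} (hS : IsPreconnected S) (hd : Disjoint S (frontier Ω)) :
    S ⊆ interior Ω ∨ S ⊆ (closure Ω)ᶜ := by
  refine hS.subset_or_subset isOpen_interior isClosed_closure.isOpen_compl ?_ fun x hx => ?_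
  · exact Set.disjoint_compl_right_iff_subset.2 (interior_subset.trans subset_closure)
  · by_contra hn
    simp only [Set.mem_union, Set.mem_compl_iff, not_or, not_not] at hn
    exact Set.disjoint_left.1 hd hx ⟨hn.2, hn.1⟩

/-- The point with polar coordinates `(ρ, θ)` in the frame of `γ` at time `s`. -/
noncomputable def framePoint (γ : ℝ → ℂ) (s ρ θ : ℝ) : ℂ :=
  γ s + ρ * (deriv γ s * Complex.exp (θ * Complex.I))

/-- The angle under which `γ t` is seen from `γ s`, measured from the tangent at `γ s`. -/
noncomputable def viewAngle (γ : ℝ → ℂ) (s t : ℝ) : ℝ :=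
  ((γ t - γ s) / deriv γ s).arg

/-- The region swept by circular arcs centred at `γ s` from the points of the forward arc to the
ray with angle `c` from the tangent. -/
def halfRegion (γ : ℝ → ℂ) (r s c : ℝ) : Set ℂ :=
  (fun q : ℝ × ℝ => framePoint γ s ‖γ q.1 - γ s‖
    (viewAngle γ s q.1 + q.2 * (c - viewAngle γ s q.1))) ''
      (Set.Ioc s (exitTime γ r s r) ×ˢ Set.Ioc 0 1)

namespace NoncriticalCurve

variable {γ : ℝ → ℂ} {L r : ℝ}

theorem framePoint_viewAngle (h : NoncriticalCurve γ L r) (s t : ℝ) :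
    framePoint γ s ‖γ t - γ s‖ (viewAngle γ s t) = γ t := by
  have h1 := Complex.norm_mul_exp_arg_mul_I ((γ t - γ s) / deriv γ s)
  rw [norm_div, h.unit_speed, div_one] at h1
  rw [framePoint, viewAngle, mul_left_comm, h1, mul_div_cancel₀ _ (h.deriv_ne_zero s)]
  ring

theorem framePoint_sub_div (h : NoncriticalCurve γ L r) (s ρ θ : ℝ) :
    (framePoint γ s ρ θ - γ s) / deriv γ s = ρ * Complex.exp (θ * Complex.I) := by
  have := h.deriv_ne_zero s
  rw [framePoint]
  field_simp
  ring

theorem norm_framePoint_sub (h : NoncriticalCurve γ L r) (s θ : ℝ) {ρ : ℝ} (hρ : 0 ≤ ρ) :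
    ‖framePoint γ s ρ θ - γ s‖ = ρ := by
  simp [framePoint, h.unit_speed, abs_of_nonneg hρ]

theorem re_div_deriv (h : NoncriticalCurve γ L r) (s : ℝ) (z : ℂ) :
    (z / deriv γ s).re = inner ℝ z (deriv γ s) := by
  rw [Complex.div_re, Complex.normSq_eq_norm_sq, h.unit_speed, Complex.inner]
  simp
  ring

theorem re_pos (h : NoncriticalCurve γ L r) {s t : ℝ} (hst : StaysClose γ r s t) (hlt : s < t) :
    0 < ((γ t - γ s) / deriv γ s).re := by
  rw [h.re_div_deriv]
  exact hst.inner_pos h hlt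

theorem abs_viewAngle_lt (h : NoncriticalCurve γ L r) {s t : ℝ} (hst : StaysClose γ r s t)
    (hlt : s < t) : |viewAngle γ s t| < Real.pi / 2 :=
  Complex.abs_arg_lt_pi_div_two_iff.2 (Or.inl (h.re_pos hst hlt))

theorem isPreconnected_halfRegion (h : NoncriticalCurve γ L r) (s c : ℝ) :
    IsPreconnected (halfRegion γ r s c) := by
  refine (isPreconnected_Ioc.prod isPreconnected_Ioc).image _ ?_
  have hc := h.continuous
  have hv : ContinuousOn (fun q : ℝ × ℝ => viewAngle γ s q.1)
      (Set.Ioc s (exitTime γ r s r) ×ˢ Set.Ioc 0 1) := by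
    intro q hq
    have h1 := h.exitTime_spec s h.radius_pos.le le_rfl
    have h2 := h.re_pos (h1.1.mono hq.1.1.le hq.1.2) hq.1.1
    refine ContinuousAt.continuousWithinAt ?_
    refine ContinuousAt.comp (f := fun q : ℝ × ℝ => (γ q.1 - γ s) / deriv γ s)
      (g := Complex.arg) (Complex.continuousAt_arg (Or.inl h2)) ?_
    fun_prop
  unfold framePoint
  fun_prop

/-- On each circle the forward arc has only its exit point, whose angle the region omits, while
backward points have strictly negative tangential component and the region has angles within `[-π/2,
π/2]`. -/
theorem disjoint_halfRegion (h : NoncriticalCurve γ L r) (s : ℝ) {c : ℝ}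
    (hc : |c| = Real.pi / 2) : Disjoint (halfRegion γ r s c) (Set.range γ) := by
  rw [Set.disjoint_left]
  rintro _ ⟨⟨t, w⟩, ⟨ht, hw⟩, rfl⟩ ⟨v, hv⟩
  dsimp only at ht hw hv
  have h1 := (h.exitTime_spec s h.radius_pos.le le_rfl).1.mono ht.1.le ht.2
  have hα := abs_lt.1 (h.abs_viewAngle_lt h1 ht.1)
  have hpi := Real.pi_pos
  set α := viewAngle γ s t
  set ρ := ‖γ t - γ s‖ with hρ
  have hρ0 : 0 < ρ := by
    rw [hρ]
    have := h1.lt h le_rfl ht.1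
    rwa [sub_self, norm_zero] at this
  set θ := α + w * (c - α) with hθ
  have hθα : θ ≠ α := by
    intro h2
    have h3 : w * (c - α) = 0 := by linarith
    rcases mul_eq_zero.1 h3 with h3 | h3
    · linarith [hw.1]
    · rw [sub_eq_zero.1 h3] at hc
      exact (h.abs_viewAngle_lt h1 ht.1).ne hc
  have hθ2 : -(Real.pi / 2) ≤ θ ∧ θ ≤ Real.pi / 2 := by
    have hcc := abs_le.1 hc.le
    constructor <;> nlinarith [hw.1, hw.2]
  have hvρ : ‖γ v - γ s‖ = ρ := by rw [hv, h.norm_framePoint_sub s θ hρ0.le]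
  obtain ⟨u, hu, hu2⟩ := h.exists_forward_or_backward s v
    (hvρ.trans_le (h1.2 t ⟨ht.1.le, le_rfl⟩))
  rcases hu2 with hu2 | hu2
  · have hut : u = t := hu2.eq h h1 (by rw [hu, hvρ])
    rw [← hu, hut, ← h.framePoint_viewAngle s t] at hv
    have h2 := congrArg (fun z => (z - γ s) / deriv γ s) hv
    rw [h.framePoint_sub_div, h.framePoint_sub_div] at h2
    have h3 := mul_left_cancel₀ (Complex.ofReal_ne_zero.2 hρ0.ne') h2
    rw [Complex.exp_eq_exp_iff_exists_int] at h3
    obtain ⟨n, hn⟩ := h3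
    have h4 : α = θ + n * (2 * Real.pi) := by
      have h5 := congrArg Complex.im hn
      simpa using h5
    have h6 : n = 0 := by
      have h7 : (n : ℝ) < 1 := by nlinarith [hθ2.1, hα.2]
      have h8 : (-1 : ℝ) < n := by nlinarith [hθ2.2, hα.1]
      have h7' : n < 1 := by exact_mod_cast h7
      have h8' : -1 < n := by exact_mod_cast h8
      omega
    rw [h6] at h4
    apply hθα
    simpa using h4.symm
  · have hlt : -s < -u := by
      refine lt_of_le_of_ne hu2.1 fun h2 => ?_
      rw [← neg_inj.1 h2] at hu
      rw [← hu, sub_self, norm_zero] at hvρ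
      linarith
    have h2 := hu2.inner_pos h.reverse hlt
    rw [deriv_comp_neg, inner_neg_right] at h2
    simp only [neg_neg] at h2
    rw [← h.re_div_deriv, hu, hv, h.framePoint_sub_div, Complex.re_ofReal_mul,
      Complex.exp_ofReal_mul_I_re] at h2
    have := Real.cos_nonneg_of_neg_pi_div_two_le_of_le hθ2.1 hθ2.2
    nlinarith

theorem framePoint_mem_halfRegion (h : NoncriticalCurve γ L r) (s : ℝ) {ρ c θ : ℝ}
    (hρ : ρ ∈ Set.Ioc 0 r)
    (hθ : viewAngle γ s (exitTime γ r s ρ) < θ ∧ θ ≤ c ∨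
      c ≤ θ ∧ θ < viewAngle γ s (exitTime γ r s ρ)) :
    framePoint γ s ρ θ ∈ halfRegion γ r s c := by
  have h1 := h.exitTime_spec s hρ.1.le hρ.2
  set t := exitTime γ r s ρ with ht
  set α := viewAngle γ s t
  have h2 : s < t := by linarith [h.add_le_exitTime s hρ.1.le hρ.2, hρ.1]
  have h3 : t ≤ exitTime γ r s r := by
    rcases eq_or_lt_of_le hρ.2 with h4 | h4
    · rw [ht, h4]
    · exact (h.exitTime_radius_lt s hρ.1.le h4 le_rfl).le
  refine ⟨(t, (θ - α) / (c - α)), ⟨⟨h2, h3⟩, ?_⟩, ?_⟩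
  · rcases hθ with hθ | hθ
    · exact ⟨div_pos (by linarith) (by linarith), (div_le_one (by linarith)).2 (by linarith)⟩
    · exact ⟨div_pos_of_neg_of_neg (by linarith) (by linarith),
        (div_le_one_of_neg (by linarith)).2 (by linarith)⟩
  · have hne : c - α ≠ 0 := by rcases hθ with hθ | hθ <;> [skip; skip] <;> intro h0 <;> linarith
    change framePoint γ s ‖γ t - γ s‖ (α + (θ - α) / (c - α) * (c - α)) = _
    rw [h1.2, div_mul_cancel₀ _ hne, add_sub_cancel]

theorem exitPoint_eq (h : NoncriticalCurve γ L r) (s : ℝ) {ρ : ℝ} (hρ : ρ ∈ Set.Ioc 0 r) :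
    exitPoint γ r s ρ =
      ρ * Complex.exp (viewAngle γ s (exitTime γ r s ρ) * Complex.I) := by
  have h1 := h.exitTime_spec s hρ.1.le hρ.2
  rw [exitPoint, ← h.framePoint_sub_div]
  congr 2
  conv_lhs => rw [← h.framePoint_viewAngle s (exitTime γ r s ρ), h1.2]

theorem abs_viewAngle_exitTime_lt (h : NoncriticalCurve γ L r) (s : ℝ) {ρ : ℝ}
    (hρ : ρ ∈ Set.Ioc 0 r) : |viewAngle γ s (exitTime γ r s ρ)| < Real.pi / 2 :=
  h.abs_viewAngle_lt (h.exitTime_spec s hρ.1.le hρ.2).1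
    (by linarith [h.add_le_exitTime s hρ.1.le hρ.2, hρ.1])

/-- A point in the forward half of the disk lies on the curve, above it or below it. -/
theorem mem_range_or_mem_halfRegion (h : NoncriticalCurve γ L r) (s : ℝ) {z : ℂ}
    (hz0 : z ≠ γ s) (hz : ‖z - γ s‖ ≤ r) (hre : 0 ≤ ((z - γ s) / deriv γ s).re) :
    z ∈ Set.range γ ∨ z ∈ halfRegion γ r s (Real.pi / 2) ∨
      z ∈ halfRegion γ r s (-(Real.pi / 2)) := by
  set ρ := ‖z - γ s‖ with hρ
  have hρ0 : ρ ∈ Set.Ioc 0 r := ⟨norm_pos_iff.2 (sub_ne_zero.2 hz0), hz⟩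
  set θ := ((z - γ s) / deriv γ s).arg with hθ
  have hzθ : framePoint γ s ρ θ = z := by
    have h1 := Complex.norm_mul_exp_arg_mul_I ((z - γ s) / deriv γ s)
    rw [norm_div, h.unit_speed, div_one] at h1
    rw [framePoint, mul_left_comm, h1, mul_div_cancel₀ _ (h.deriv_ne_zero s)]
    ring
  have hθ2 := abs_le.1 (Complex.abs_arg_le_pi_div_two_iff.2 hre)
  rw [← hzθ]
  rcases lt_trichotomy θ (viewAngle γ s (exitTime γ r s ρ)) with h1 | h1 | h1
  · exact Or.inr (Or.inr (h.framePoint_mem_halfRegion s hρ0 (Or.inr ⟨hθ2.1, h1⟩)))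
  · left
    have h2 := h.framePoint_viewAngle s (exitTime γ r s ρ)
    rw [(h.exitTime_spec s hρ0.1.le hρ0.2).2] at h2
    rw [h1, h2]
    exact Set.mem_range_self _
  · exact Or.inr (Or.inl (h.framePoint_mem_halfRegion s hρ0 (Or.inl ⟨h1, hθ2.2⟩)))

end NoncriticalCurve

/-! ### Gluing the forward and backward halves of the disk. -/

theorem framePoint_add_pi (γ : ℝ → ℂ) (s ρ θ : ℝ) :
    framePoint γ s ρ (θ + Real.pi) = framePoint (fun v => γ (-v)) (-s) ρ θ := by
  simp only [framePoint, deriv_comp_neg, neg_neg]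
  push_cast
  rw [add_mul, Complex.exp_add, Complex.exp_pi_mul_I]
  ring

theorem framePoint_sub_pi (γ : ℝ → ℂ) (s ρ θ : ℝ) :
    framePoint γ s ρ (θ - Real.pi) = framePoint (fun v => γ (-v)) (-s) ρ θ := by
  simp only [framePoint, deriv_comp_neg, neg_neg]
  push_cast
  rw [sub_mul, Complex.exp_sub, Complex.exp_pi_mul_I]
  ring

theorem framePoint_periodic (γ : ℝ → ℂ) (s ρ : ℝ) :
    Function.Periodic (framePoint γ s ρ) (2 * Real.pi) := by
  intro θ
  have h1 := framePoint_add_pi γ s ρ (θ + Real.pi)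
  rw [← framePoint_sub_pi, add_sub_cancel_right] at h1
  rw [← h1]
  congr 1
  ring

/-- The angle at `γ s`, measured from the tangent, of the point where the backward arc leaves the
disk of radius `ρ`. -/
noncomputable def backAngle (γ : ℝ → ℂ) (r s ρ : ℝ) : ℝ :=
  Real.pi + viewAngle (fun v => γ (-v)) (-s) (exitTime (fun v => γ (-v)) r (-s) ρ)

/-- The angle at `γ s`, measured from the tangent, of the point where the forward arc leaves the
disk of radius `ρ`. -/
noncomputable def foreAngle (γ : ℝ → ℂ) (r s ρ : ℝ) : ℝ :=
  viewAngle γ s (exitTime γ r s ρ)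

namespace NoncriticalCurve

variable {Ω : Set ℂ} {γ : ℝ → ℂ} {L r : ℝ}

theorem foreAngle_mem (h : NoncriticalCurve γ L r) (s : ℝ) {ρ : ℝ} (hρ : ρ ∈ Set.Ioc 0 r) :
    foreAngle γ r s ρ ∈ Set.Ioo (-(Real.pi / 2)) (Real.pi / 2) :=
  abs_lt.1 (h.abs_viewAngle_exitTime_lt s hρ)

theorem backAngle_mem (h : NoncriticalCurve γ L r) (s : ℝ) {ρ : ℝ} (hρ : ρ ∈ Set.Ioc 0 r) :
    backAngle γ r s ρ ∈ Set.Ioo (Real.pi / 2) (3 * Real.pi / 2) := by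
  have := abs_lt.1 (h.reverse.abs_viewAngle_exitTime_lt (-s) hρ)
  constructor <;> unfold backAngle <;> linarith [this.1, this.2]

theorem halfRegion_subset (h : NoncriticalCurve γ L r) (hΩ : IsClosed Ω)
    (hr : Set.range γ = frontier Ω) (s : ℝ) {c : ℝ} (hc : |c| = Real.pi / 2) :
    halfRegion γ r s c ⊆ interior Ω ∨ halfRegion γ r s c ⊆ Ωᶜ := by
  have := (h.isPreconnected_halfRegion s c).subset_interior_or_subset_compl_closure
    (Ω := Ω) (hr ▸ h.disjoint_halfRegion s hc)
  rwa [hΩ.closure_eq] at this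

theorem framePoint_pi_div_two_mem (h : NoncriticalCurve γ L r) (s : ℝ) {ρ : ℝ}
    (hρ : ρ ∈ Set.Ioc 0 r) :
    framePoint γ s ρ (Real.pi / 2) ∈ halfRegion γ r s (Real.pi / 2) :=
  h.framePoint_mem_halfRegion s hρ (Or.inl ⟨(h.foreAngle_mem s hρ).2, le_rfl⟩)

theorem framePoint_neg_pi_div_two_mem (h : NoncriticalCurve γ L r) (s : ℝ) {ρ : ℝ}
    (hρ : ρ ∈ Set.Ioc 0 r) :
    framePoint γ s ρ (-(Real.pi / 2)) ∈ halfRegion γ r s (-(Real.pi / 2)) :=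
  h.framePoint_mem_halfRegion s hρ (Or.inr ⟨le_rfl, (h.foreAngle_mem s hρ).1⟩)

end NoncriticalCurve

theorem abs_pi_div_two : |Real.pi / 2| = Real.pi / 2 := abs_of_pos (by positivity)

theorem abs_neg_pi_div_two : |-(Real.pi / 2)| = Real.pi / 2 := by rw [abs_neg, abs_pi_div_two]

namespace IsC1Shape

variable {Ω : Set ℂ} {L r : ℝ} {γ : ℝ → ℂ}

theorem range_reverse_eq (h : IsC1Shape Ω L γ) : Set.range (fun v => γ (-v)) = frontier Ω := by
  rw [← h.range_eq]
  exact (neg_surjective (G := ℝ)).range_comp γ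

/-- Both connected regions contain the left normal ray at angle `π/2`, and the orientation
hypothesis places points of that ray in the interior. -/
theorem halfRegions_subset_interior (h : IsC1Shape Ω L γ) (hn : NoncriticalCurve γ L r) (s : ℝ) :
    halfRegion γ r s (Real.pi / 2) ⊆ interior Ω ∧
      halfRegion (fun v => γ (-v)) r (-s) (-(Real.pi / 2)) ⊆ interior Ω := by
  have hΩ := h.isCompact.isClosed
  obtain ⟨ε, hε, hεr⟩ := ((h.interior_left s).and (Ioc_mem_nhdsGT hn.radius_pos)).exists
  have hp : γ s + ε * (Complex.I * deriv γ s) = framePoint γ s ε (Real.pi / 2) := by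
    rw [framePoint]
    push_cast
    rw [Complex.exp_pi_div_two_mul_I]
    ring
  rw [hp] at hε
  constructor
  · refine (hn.halfRegion_subset hΩ h.range_eq s abs_pi_div_two).resolve_right fun hc => ?_
    exact hc (hn.framePoint_pi_div_two_mem s hεr) (interior_subset hε)
  · refine (hn.reverse.halfRegion_subset hΩ h.range_reverse_eq (-s)
      abs_neg_pi_div_two).resolve_right fun hc => ?_
    refine hc (hn.reverse.framePoint_neg_pi_div_two_mem (-s) hεr) ?_
    rw [← framePoint_add_pi, show -(Real.pi / 2) + Real.pi = Real.pi / 2 by ring]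
    exact interior_subset hε

/-- The orientation says nothing about the right side. The two regions share the ray at angle
`-π/2`, so they lie on the same side of the boundary; and `γ s` is a limit of points outside `Ω`,
which can only lie in these regions. -/
theorem halfRegions_subset_compl (h : IsC1Shape Ω L γ) (hn : NoncriticalCurve γ L r) (s : ℝ) :
    halfRegion γ r s (-(Real.pi / 2)) ⊆ Ωᶜ ∧
      halfRegion (fun v => γ (-v)) r (-s) (Real.pi / 2) ⊆ Ωᶜ := by
  have hΩ := h.isCompact.isClosed
  have hr0 := hn.radius_pos
  have hfr : frontier Ω ⊆ Ω := hΩ.frontier_subset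
  have hint := h.halfRegions_subset_interior hn s
  have hd1 := hn.halfRegion_subset hΩ h.range_eq s abs_neg_pi_div_two
  have hd2 := hn.reverse.halfRegion_subset hΩ h.range_reverse_eq (-s) abs_pi_div_two
  have hm1 := hn.framePoint_neg_pi_div_two_mem s ⟨hr0, le_rfl⟩
  have hm2 := hn.reverse.framePoint_pi_div_two_mem (-s) ⟨hr0, le_rfl⟩
  rw [← framePoint_sub_pi, show Real.pi / 2 - Real.pi = -(Real.pi / 2) by ring] at hm2
  have hiff : halfRegion γ r s (-(Real.pi / 2)) ⊆ Ωᶜ ↔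
      halfRegion (fun v => γ (-v)) r (-s) (Real.pi / 2) ⊆ Ωᶜ := by
    constructor
    · intro h1
      exact hd2.resolve_left fun h2 => h1 hm1 (interior_subset (h2 hm2))
    · intro h1
      exact hd1.resolve_left fun h2 => h1 hm2 (interior_subset (h2 hm1))
  have hcl : γ s ∈ closure Ωᶜ := by
    have := h.mem_frontier s
    rw [frontier_eq_closure_inter_closure] at this
    exact this.2
  obtain ⟨z, hz, hzr⟩ := Metric.mem_closure_iff.1 hcl r hr0
  rw [dist_comm, dist_eq_norm] at hzr
  have hz0 : z ≠ γ s := fun h1 => hz (h1 ▸ hfr (h.mem_frontier s))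
  rcases le_total 0 ((z - γ s) / deriv γ s).re with hre | hre
  · rcases hn.mem_range_or_mem_halfRegion s hz0 hzr.le hre with h1 | h1 | h1
    · exact absurd (hfr (h.range_eq ▸ h1)) hz
    · exact absurd (interior_subset (hint.1 h1)) hz
    · have h2 := hd1.resolve_left fun h2 => hz (interior_subset (h2 h1))
      exact ⟨h2, hiff.1 h2⟩
  · rcases hn.reverse.mem_range_or_mem_halfRegion (-s) (z := z) (by simpa using hz0)
      (by simpa using hzr.le) (by
        rw [deriv_comp_neg, neg_neg, div_neg, Complex.neg_re]; linarith) with h1 | h1 | h1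
    · exact absurd (hfr (h.range_reverse_eq ▸ h1)) hz
    · have h2 := hd2.resolve_left fun h2 => hz (interior_subset (h2 h1))
      exact ⟨hiff.2 h2, h2⟩
    · exact absurd (interior_subset (hint.2 h1)) hz

theorem framePoint_mem_interior (h : IsC1Shape Ω L γ) (hn : NoncriticalCurve γ L r) (s : ℝ)
    {ρ θ : ℝ} (hρ : ρ ∈ Set.Ioc 0 r)
    (hθ : θ ∈ Set.Ioo (foreAngle γ r s ρ) (backAngle γ r s ρ)) :
    framePoint γ s ρ θ ∈ interior Ω := by
  have hint := h.halfRegions_subset_interior hn s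
  rcases le_total θ (Real.pi / 2) with h1 | h1
  · exact hint.1 (hn.framePoint_mem_halfRegion s hρ (Or.inl ⟨hθ.1, h1⟩))
  · rw [← sub_add_cancel θ Real.pi, framePoint_add_pi]
    have h2 := hθ.2
    unfold backAngle at h2
    exact hint.2 (hn.reverse.framePoint_mem_halfRegion (-s) hρ
      (Or.inr ⟨by linarith, by linarith⟩))

theorem framePoint_notMem (h : IsC1Shape Ω L γ) (hn : NoncriticalCurve γ L r) (s : ℝ)
    {ρ θ : ℝ} (hρ : ρ ∈ Set.Ioc 0 r)
    (hθ : θ ∈ Set.Ioo (backAngle γ r s ρ - 2 * Real.pi) (foreAngle γ r s ρ)) :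
    framePoint γ s ρ θ ∈ Ωᶜ := by
  have hout := h.halfRegions_subset_compl hn s
  rcases le_total (-(Real.pi / 2)) θ with h1 | h1
  · exact hout.1 (hn.framePoint_mem_halfRegion s hρ (Or.inr ⟨h1, hθ.2⟩))
  · rw [← add_sub_cancel_right θ Real.pi, framePoint_sub_pi]
    have h2 := hθ.1
    unfold backAngle at h2
    exact hout.2 (hn.reverse.framePoint_mem_halfRegion (-s) hρ
      (Or.inl ⟨by linarith, by linarith⟩))

end IsC1Shape

/-! ### Area of `Ω` in a moving disk, in polar coordinates about a fixed point. -/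

/-- The distance from the origin to the circle of radius `R` about `v`, in the direction `θ`. -/
noncomputable def radialDist (v : ℂ) (R θ : ℝ) : ℝ :=
  (v * Complex.exp (-θ * Complex.I)).re +
    √(R ^ 2 - (v * Complex.exp (-θ * Complex.I)).im ^ 2)

theorem norm_mul_exp_neg_mul_I (v : ℂ) (θ : ℝ) : ‖v * Complex.exp (-θ * Complex.I)‖ = ‖v‖ := by
  rw [norm_mul, ← Complex.ofReal_neg, Complex.norm_exp_ofReal_mul_I, mul_one]

/-- After rotating the ray onto the real axis this is a quadratic inequality in `ρ`. Its lower root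
is nonpositive because the disk contains the origin, so only the upper root matters. -/
theorem norm_sub_le_iff_le_radialDist {v : ℂ} {R θ ρ : ℝ} (hv : ‖v‖ ≤ R) (hρ : 0 ≤ ρ) :
    ‖ρ * Complex.exp (θ * Complex.I) - v‖ ≤ R ↔ ρ ≤ radialDist v R θ := by
  set w := v * Complex.exp (-θ * Complex.I) with hw
  have hwn : ‖w‖ = ‖v‖ := norm_mul_exp_neg_mul_I v θ
  have hR : 0 ≤ R := (norm_nonneg v).trans hv
  have h1 : ‖ρ * Complex.exp (θ * Complex.I) - v‖ = ‖(ρ : ℂ) - w‖ := by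
    have : ρ * Complex.exp (θ * Complex.I) - v = (ρ - w) * Complex.exp (θ * Complex.I) := by
      rw [hw, sub_mul, mul_assoc, ← Complex.exp_add]
      simp
    rw [this, norm_mul, Complex.norm_exp_ofReal_mul_I, mul_one]
  have h2 : ‖(ρ : ℂ) - w‖ ≤ R ↔ (ρ - w.re) ^ 2 ≤ R ^ 2 - w.im ^ 2 := by
    rw [← sq_le_sq₀ (norm_nonneg _) hR, ← Complex.normSq_eq_norm_sq, Complex.normSq_apply]
    simp only [Complex.sub_re, Complex.sub_im, Complex.ofReal_re, Complex.ofReal_im]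
    constructor <;> intro h <;> linarith [h]
  have h3 : w.re ^ 2 ≤ R ^ 2 - w.im ^ 2 := by
    have h4 : ‖w‖ ^ 2 ≤ R ^ 2 := pow_le_pow_left₀ (norm_nonneg _) (hwn.trans_le hv) 2
    rw [← Complex.normSq_eq_norm_sq, Complex.normSq_apply] at h4
    linarith
  rw [h1, h2, radialDist, ← hw, ← sub_le_iff_le_add']
  constructor
  · intro h; exact (abs_le.1 (Real.abs_le_sqrt h)).2
  · intro h
    have h5 := (abs_le.1 (Real.abs_le_sqrt h3)).2
    rw [← Real.sq_sqrt ((sq_nonneg _).trans h3)]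
    refine sq_le_sq' (by linarith) h

theorem abs_radialDist_sub_le {v : ℂ} {R θ : ℝ} (hv : ‖v‖ ≤ R) :
    |radialDist v R θ - R| ≤ 2 * ‖v‖ := by
  rw [radialDist]
  set w := v * Complex.exp (-θ * Complex.I) with hw
  have hwn : ‖w‖ = ‖v‖ := norm_mul_exp_neg_mul_I v θ
  have hR : 0 ≤ R := (norm_nonneg v).trans hv
  have h1 := Complex.abs_re_le_norm w
  have h2 := Complex.abs_im_le_norm w
  rw [hwn] at h1 h2
  have h3 := abs_le.1 h1
  have h4 : √(R ^ 2 - w.im ^ 2) ≤ R := by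
    rw [Real.sqrt_le_left hR]; nlinarith [sq_nonneg w.im]
  have h5 : R - |w.im| ≤ √(R ^ 2 - w.im ^ 2) := by
    apply Real.le_sqrt_of_sq_le
    nlinarith [abs_nonneg w.im, sq_abs w.im]
  rw [abs_le]
  constructor <;> linarith

theorem hasDerivAt_radialDist {v : ℝ → ℂ} {R : ℝ → ℝ} {x₀ : ℝ} {v' : ℂ} {R' : ℝ}
    (hv : HasDerivAt v v' x₀) (hR : HasDerivAt R R' x₀) (hv0 : v x₀ = 0) (hR0 : 0 < R x₀)
    (θ : ℝ) : HasDerivAt (fun x => radialDist (v x) (R x) θ)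
      ((v' * Complex.exp (-θ * Complex.I)).re + R') x₀ := by
  have hw := hv.mul_const (Complex.exp (-θ * Complex.I))
  have hre : HasDerivAt (fun x => (v x * Complex.exp (-θ * Complex.I)).re)
      (v' * Complex.exp (-θ * Complex.I)).re x₀ :=
    Complex.reCLM.hasFDerivAt.comp_hasDerivAt x₀ hw
  have him : HasDerivAt (fun x => (v x * Complex.exp (-θ * Complex.I)).im)
      (v' * Complex.exp (-θ * Complex.I)).im x₀ :=
    Complex.imCLM.hasFDerivAt.comp_hasDerivAt x₀ hw
  have hin := (hR.fun_pow 2).sub (him.fun_pow 2)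
  have hne : R x₀ ^ 2 - (v x₀ * Complex.exp (-θ * Complex.I)).im ^ 2 ≠ 0 := by
    simp [hv0, hR0.ne']
  refine (hre.add (hin.sqrt hne)).congr_deriv ?_
  have him0 : (v x₀ * Complex.exp (-θ * Complex.I)).im = 0 := by simp [hv0]
  simp only [Pi.sub_apply, him0]
  norm_num
  rw [Real.sqrt_sq hR0.le]
  field_simp

theorem continuous_radialDist (v : ℂ) (R : ℝ) : Continuous (radialDist v R) := by
  unfold radialDist
  fun_prop

/-- The density in polar coordinates about `p` of the area of `Ω`. -/
noncomputable def polarDensity (Ω : Set ℂ) (p T : ℂ) (θ ρ : ℝ) : ℝ :=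
  ρ * Ω.indicator 1 (p + ρ * (T * Complex.exp (θ * Complex.I)))

section

variable {Ω : Set ℂ} {p T : ℂ}

theorem norm_polarDensity_le (Ω : Set ℂ) (p T : ℂ) (θ ρ : ℝ) :
    ‖polarDensity Ω p T θ ρ‖ ≤ |ρ| := by
  rw [polarDensity, norm_mul]
  refine mul_le_of_le_one_right (abs_nonneg _) ?_
  by_cases h : p + ρ * (T * Complex.exp (θ * Complex.I)) ∈ Ω <;> simp [h]

theorem measurable_polarDensity (hΩ : MeasurableSet Ω) (p T : ℂ) :
    Measurable fun q : ℝ × ℝ => polarDensity Ω p T q.1 q.2 := by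
  unfold polarDensity
  refine measurable_snd.mul ?_
  refine (measurable_one.indicator hΩ).comp (Continuous.measurable ?_)
  fun_prop

theorem measurable_polarDensity_right (hΩ : MeasurableSet Ω) (p T : ℂ) (θ : ℝ) :
    Measurable (polarDensity Ω p T θ) :=
  (measurable_polarDensity hΩ p T).comp measurable_prodMk_left

theorem intervalIntegrable_polarDensity (hΩ : MeasurableSet Ω) (p T : ℂ) (θ a b : ℝ) :
    IntervalIntegrable (polarDensity Ω p T θ) MeasureTheory.volume a b :=
  (continuous_id.intervalIntegrable a b).mono_fun
    (measurable_polarDensity_right hΩ p T θ).aestronglyMeasurable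
    (Filter.Eventually.of_forall fun ρ => norm_polarDensity_le Ω p T θ ρ)

theorem hasDerivAt_integral_polarDensity (hΩ : IsClosed Ω) {θ R : ℝ}
    (h : p + R * (T * Complex.exp (θ * Complex.I)) ∉ frontier Ω) :
    HasDerivAt (fun x => ∫ ρ in (0 : ℝ)..x, polarDensity Ω p T θ ρ)
      (polarDensity Ω p T θ R) R := by
  refine intervalIntegral.integral_hasDerivAt_right
    (intervalIntegrable_polarDensity hΩ.measurableSet p T θ 0 R)
    (measurable_polarDensity_right hΩ.measurableSet p T θ).stronglyMeasurable.stronglyMeasurableAtFilter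
    ?_
  have hc : ContinuousAt (fun ρ : ℝ => p + ρ * (T * Complex.exp (θ * Complex.I))) R := by
    fun_prop
  have hcont : ContinuousAt (Ω.indicator (1 : ℂ → ℝ))
      (p + R * (T * Complex.exp (θ * Complex.I))) :=
    continuous_one.continuousOn.continuousAt_indicator h
  exact continuousAt_id.mul (ContinuousAt.comp (g := Ω.indicator (1 : ℂ → ℝ)) hcont hc)

theorem integrableOn_polarDensity_indicator (hΩ : MeasurableSet Ω) (p T : ℂ) {v : ℂ} {R : ℝ}
    (hv : ‖v‖ ≤ R) :
    MeasureTheory.IntegrableOn (fun q : ℝ × ℝ =>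
      {q : ℝ × ℝ | q.1 ≤ radialDist v R q.2}.indicator
        (fun q => polarDensity Ω p T q.2 q.1) q)
      (Set.Ioi 0 ×ˢ Set.Ioo (-Real.pi) Real.pi) := by
  have hms : MeasurableSet {q : ℝ × ℝ | q.1 ≤ radialDist v R q.2} := by
    refine measurableSet_le measurable_fst ?_
    exact ((continuous_radialDist v R).comp continuous_snd).measurable
  have hmf : Measurable fun q : ℝ × ℝ => polarDensity Ω p T q.2 q.1 :=
    (measurable_polarDensity hΩ p T).comp measurable_swap
  have hbd : ∀ θ, radialDist v R θ ≤ 3 * R := fun θ => by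
    have := (abs_le.1 (abs_radialDist_sub_le (θ := θ) hv)).2
    linarith
  refine MeasureTheory.IntegrableOn.of_forall_sdiff_eq_zero
    (s := Set.Ioc 0 (3 * R) ×ˢ Set.Ioo (-Real.pi) Real.pi) ?_
    (measurableSet_Ioi.prod measurableSet_Ioo) ?_
  · refine MeasureTheory.Measure.integrableOn_of_bounded (M := 3 * R) ?_
      (hmf.indicator hms).aestronglyMeasurable ?_
    · rw [MeasureTheory.Measure.volume_eq_prod, MeasureTheory.Measure.prod_prod, Real.volume_Ioc,
        Real.volume_Ioo]
      exact ENNReal.mul_ne_top ENNReal.ofReal_ne_top ENNReal.ofReal_ne_top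
    · refine (MeasureTheory.ae_restrict_iff'
        (measurableSet_Ioc.prod measurableSet_Ioo)).2 (Filter.Eventually.of_forall ?_)
      rintro ⟨ρ, θ⟩ ⟨hρ, -⟩
      refine (norm_indicator_le_norm_self _ _).trans ((norm_polarDensity_le Ω p T θ ρ).trans ?_)
      rw [abs_of_pos hρ.1]
      exact hρ.2
  · rintro ⟨ρ, θ⟩ ⟨⟨h1, h2⟩, h3⟩
    refine Set.indicator_of_notMem (fun h4 => h3 ⟨⟨h1, ?_⟩, h2⟩) _
    exact le_trans h4 (hbd θ)

theorem setIntegral_polarDensity_indicator (Ω : Set ℂ) (p T : ℂ) {v : ℂ} {R : ℝ} (hv : ‖v‖ ≤ R)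
    (θ : ℝ) :
    ∫ ρ in Set.Ioi 0, {q : ℝ × ℝ | q.1 ≤ radialDist v R q.2}.indicator
        (fun q => polarDensity Ω p T q.2 q.1) (ρ, θ) =
      ∫ ρ in (0 : ℝ)..radialDist v R θ, polarDensity Ω p T θ ρ := by
  have h0 : 0 ≤ radialDist v R θ :=
    (norm_sub_le_iff_le_radialDist hv le_rfl).1 (by simpa using hv)
  have h1 : ∀ ρ, {q : ℝ × ℝ | q.1 ≤ radialDist v R q.2}.indicator
        (fun q => polarDensity Ω p T q.2 q.1) (ρ, θ) =
      (Set.Iic (radialDist v R θ)).indicator (polarDensity Ω p T θ) ρ := by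
    intro ρ
    simp only [Set.indicator, Set.mem_ofPred_eq, Set.mem_Iic]
  simp_rw [h1]
  rw [MeasureTheory.setIntegral_indicator measurableSet_Iic, Set.Ioi_inter_Iic,
    intervalIntegral.integral_of_le h0]

theorem integrableOn_integral_polarDensity (hΩ : MeasurableSet Ω) (p T : ℂ) {v : ℂ} {R : ℝ}
    (hv : ‖v‖ ≤ R) :
    MeasureTheory.IntegrableOn
      (fun θ => ∫ ρ in (0 : ℝ)..radialDist v R θ, polarDensity Ω p T θ ρ)
      (Set.Ioo (-Real.pi) Real.pi) := by
  have h := integrableOn_polarDensity_indicator hΩ p T hv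
  rw [MeasureTheory.IntegrableOn, MeasureTheory.Measure.volume_eq_prod,
    ← MeasureTheory.Measure.prod_restrict] at h
  refine h.integral_prod_right.congr (Filter.Eventually.of_forall fun θ => ?_)
  exact setIntegral_polarDensity_indicator Ω p T hv θ

/-- The area of the intersection of `Ω` with a disk containing `p`, in polar coordinates
about `p`. -/
theorem volume_inter_closedBall_eq (hΩ : MeasurableSet Ω) (p : ℂ) {T : ℂ} (hT : ‖T‖ = 1) {v : ℂ}
    {R : ℝ} (hv : ‖v‖ ≤ R) :
    (MeasureTheory.volume (Ω ∩ Metric.closedBall (p + T * v) R)).toReal =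
      ∫ θ in Set.Ioo (-Real.pi) Real.pi,
        ∫ ρ in (0 : ℝ)..radialDist v R θ, polarDensity Ω p T θ ρ := by
  set S := Ω ∩ Metric.closedBall (p + T * v) R with hS
  have hSm : MeasurableSet S := hΩ.inter Metric.isClosed_closedBall.measurableSet
  have h1 : (MeasureTheory.volume S).toReal = ∫ z, S.indicator (1 : ℂ → ℝ) z :=
    (MeasureTheory.integral_indicator_one hSm).symm
  let c : Circle := ⟨T, mem_sphere_zero_iff_norm.2 hT⟩
  have h2 : ∫ z, S.indicator (1 : ℂ → ℝ) z = ∫ z, S.indicator (1 : ℂ → ℝ) (p + T * z) := by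
    rw [← MeasureTheory.integral_add_left_eq_self _ p]
    exact ((rotation c).measurePreserving.integral_comp
      (rotation c).toHomeomorph.measurableEmbedding
      (fun z => S.indicator (1 : ℂ → ℝ) (p + z))).symm
  rw [h1, h2, ← Complex.integral_comp_polarCoord_symm]
  have h3 : ∀ q ∈ polarCoord.target,
      q.1 • S.indicator (1 : ℂ → ℝ) (p + T * Complex.polarCoord.symm q) =
      {q : ℝ × ℝ | q.1 ≤ radialDist v R q.2}.indicator
        (fun q => polarDensity Ω p T q.2 q.1) q := by
    rintro ⟨ρ, θ⟩ ⟨hρ, -⟩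
    have hρ' : (0 : ℝ) ≤ ρ := le_of_lt hρ
    have h4 : p + T * Complex.polarCoord.symm (ρ, θ) =
        p + ρ * (T * Complex.exp (θ * Complex.I)) := by
      rw [Complex.polarCoord_symm_apply, Complex.exp_mul_I]
      push_cast
      ring
    have h5 : p + ρ * (T * Complex.exp (θ * Complex.I)) ∈ Metric.closedBall (p + T * v) R ↔
        ρ ≤ radialDist v R θ := by
      rw [← norm_sub_le_iff_le_radialDist hv hρ', mem_closedBall_iff_norm,
        show p + ρ * (T * Complex.exp (θ * Complex.I)) - (p + T * v) =
          T * (ρ * Complex.exp (θ * Complex.I) - v) by ring, norm_mul, hT, one_mul]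
    have h8 : p + ρ * (T * Complex.exp (θ * Complex.I)) ∈ S ↔
        p + ρ * (T * Complex.exp (θ * Complex.I)) ∈ Ω ∧ ρ ≤ radialDist v R θ := by
      rw [hS, Set.mem_inter_iff, h5]
    rw [h4]
    by_cases h7 : ρ ≤ radialDist v R θ
    · rw [Set.indicator_of_mem (show (ρ, θ) ∈ {q : ℝ × ℝ | q.1 ≤ radialDist v R q.2} from h7),
        polarDensity, smul_eq_mul]
      by_cases h6 : p + ρ * (T * Complex.exp (θ * Complex.I)) ∈ Ω
      · rw [Set.indicator_of_mem h6, Set.indicator_of_mem (h8.2 ⟨h6, h7⟩)]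
      · rw [Set.indicator_of_notMem h6, Set.indicator_of_notMem fun h => h6 (h8.1 h).1]
    · rw [Set.indicator_of_notMem
          (show (ρ, θ) ∉ {q : ℝ × ℝ | q.1 ≤ radialDist v R q.2} from h7),
        Set.indicator_of_notMem fun h => h7 (h8.1 h).2, smul_zero]
  rw [MeasureTheory.setIntegral_congr_fun polarCoord.open_target.measurableSet h3,
    polarCoord_target, MeasureTheory.Measure.volume_eq_prod,
    ← MeasureTheory.Measure.prod_restrict, MeasureTheory.integral_prod_symm]
  · simp_rw [setIntegral_polarDensity_indicator Ω p T hv]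
  · rw [MeasureTheory.Measure.prod_restrict]
    exact integrableOn_polarDensity_indicator hΩ p T hv

/-- The derivative of the area of the intersection of `Ω` with a moving disk. -/
theorem hasDerivAt_volume_inter_closedBall (hΩ : IsClosed Ω) (p : ℂ) {T : ℂ} (hT : ‖T‖ = 1)
    {v : ℝ → ℂ} {R : ℝ → ℝ} {x₀ : ℝ} {v' : ℂ} {R' : ℝ}
    (hv : HasDerivAt v v' x₀) (hR : HasDerivAt R R' x₀) (hv0 : v x₀ = 0) (hR0 : 0 < R x₀)
    (hnull : ∀ᵐ θ : ℝ ∂(MeasureTheory.volume.restrict (Set.Ioo (-Real.pi) Real.pi)),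
      p + R x₀ * (T * Complex.exp (θ * Complex.I)) ∉ frontier Ω) :
    HasDerivAt
      (fun x => areaInvariant Ω (fun y => p + T * v y) x (R x))
      (∫ θ in Set.Ioo (-Real.pi) Real.pi, polarDensity Ω p T θ (R x₀) *
        ((v' * Complex.exp (-θ * Complex.I)).re + R')) x₀ := by
  have hΩm := hΩ.measurableSet
  set R₀ := R x₀ with hR₀
  obtain ⟨C₁, hC₁⟩ := hv.isBigO_sub.bound
  obtain ⟨C₂, hC₂⟩ := hR.isBigO_sub.bound
  have hvc : Filter.Tendsto (fun x => ‖v x‖) (𝓝 x₀) (𝓝 0) := by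
    simpa [hv0] using hv.continuousAt.norm.tendsto
  have hs : ∀ᶠ x in 𝓝 x₀, ‖v x‖ ≤ C₁ * ‖x - x₀‖ ∧ |R x - R₀| ≤ C₂ * ‖x - x₀‖ ∧
      ‖v x‖ ≤ R x ∧ R x ≤ 2 * R₀ := by
    have e1 := hvc.eventually (ge_mem_nhds (show 0 < R₀ / 2 by positivity))
    have e2 := hR.continuousAt.tendsto.eventually (Icc_mem_nhds
      (show R₀ / 2 < R x₀ by rw [← hR₀]; linarith) (show R x₀ < 2 * R₀ by rw [← hR₀]; linarith))
    filter_upwards [hC₁, hC₂, e1, e2] with x h1 h2 h3 h4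
    rw [hv0, sub_zero] at h1
    exact ⟨h1, h2, h3.trans h4.1, h4.2⟩
  set F : ℝ → ℝ → ℝ := fun x θ =>
    ∫ ρ in (0 : ℝ)..radialDist (v x) (R x) θ, polarDensity Ω p T θ ρ with hF
  have hrad0 : ∀ θ, radialDist (v x₀) (R x₀) θ = R₀ := fun θ => by
    rw [hv0, ← sub_eq_zero, ← abs_eq_zero]
    have := abs_radialDist_sub_le (v := 0) (R := R₀) (θ := θ) (by simpa using hR0.le)
    rw [norm_zero, mul_zero] at this
    exact le_antisymm this (abs_nonneg _)
  set D : ℝ → ℝ := fun θ => polarDensity Ω p T θ R₀ *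
    ((v' * Complex.exp (-θ * Complex.I)).re + R') with hD
  have hDm : Measurable D := by
    refine Measurable.mul ?_ (Continuous.measurable (by fun_prop))
    exact (measurable_polarDensity hΩm p T).comp measurable_prodMk_right
  -- Lipschitz constant: the radial distance moves at rate at most `2 * C₁ + C₂`, and the density is
  -- at most `ρ ≤ 6 * R₀`, since the radial distance is at most `3 * R x` with `R x ≤ 2 * R₀`.
  have key := hasFDerivAt_integral_of_dominated_loc_of_lip' (𝕜 := ℝ)
    (μ := MeasureTheory.volume.restrict (Set.Ioo (-Real.pi) Real.pi)) (F := F) (x₀ := x₀)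
    (F' := fun θ => ContinuousLinearMap.toSpanSingleton ℝ (D θ))
    (bound := fun _ => 6 * R₀ * (2 * C₁ + C₂)) hs ?_ ?_ ?_ ?_ ?_ ?_
  · have h1 := key.2.hasDerivAt
    rw [ContinuousLinearMap.integral_apply key.1] at h1
    simp only [ContinuousLinearMap.toSpanSingleton_apply, one_smul] at h1
    refine h1.congr_of_eventuallyEq ?_
    filter_upwards [hs] with x hx using volume_inter_closedBall_eq hΩm p hT hx.2.2.1
  · intro x hx
    exact (integrableOn_integral_polarDensity hΩm p T hx.2.2.1).aestronglyMeasurable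
  · exact integrableOn_integral_polarDensity hΩm p T hs.self_of_nhds.2.2.1
  · exact ((ContinuousLinearMap.toSpanSingletonCLE
      (𝕜 := ℝ) (E := ℝ)).continuous.measurable.comp hDm).aestronglyMeasurable
  · refine Filter.Eventually.of_forall fun θ x hx => ?_
    have h1 := abs_radialDist_sub_le (θ := θ) hx.2.2.1
    have h2 : |radialDist (v x) (R x) θ - R₀| ≤ (2 * C₁ + C₂) * ‖x - x₀‖ := by
      have h3 := abs_sub_le (radialDist (v x) (R x) θ) (R x) R₀
      nlinarith [hx.1, hx.2.1]
    have h3 : 0 ≤ radialDist (v x) (R x) θ :=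
      (norm_sub_le_iff_le_radialDist hx.2.2.1 le_rfl).1 (by simpa using hx.2.2.1)
    have h4 : radialDist (v x) (R x) θ ≤ 6 * R₀ := by
      have := (abs_le.1 h1).2
      linarith [hx.2.2.1, hx.2.2.2]
    simp only [hF]
    rw [hrad0, intervalIntegral.integral_interval_sub_left
      (intervalIntegrable_polarDensity hΩm p T θ _ _)
      (intervalIntegrable_polarDensity hΩm p T θ _ _)]
    refine (intervalIntegral.norm_integral_le_of_norm_le_const (C := 6 * R₀) fun ρ hρ => ?_).trans ?_
    · refine (norm_polarDensity_le Ω p T θ ρ).trans ?_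
      have h5 := Set.uIoc_subset_uIcc hρ
      have h6 := (Set.uIcc_subset_Icc (⟨hR0.le, by linarith⟩ : R₀ ∈ Set.Icc 0 (6 * R₀))
        ⟨h3, h4⟩) h5
      rw [abs_of_nonneg h6.1]
      exact h6.2
    · rw [mul_assoc (6 * R₀)]
      exact mul_le_mul_of_nonneg_left h2 (by linarith)
  · exact MeasureTheory.integrable_const _
  · filter_upwards [hnull] with θ hθ
    have h1 : HasDerivAt (fun x => ∫ ρ in (0 : ℝ)..x, polarDensity Ω p T θ ρ)
        (polarDensity Ω p T θ R₀) (radialDist (v x₀) (R x₀) θ) := by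
      rw [hrad0]
      exact hasDerivAt_integral_polarDensity hΩ hθ
    exact (h1.comp x₀ (hasDerivAt_radialDist hv hR hv0 hR0 θ)).hasFDerivAt

end

/-! ### The partial derivatives of the area invariant. -/

namespace IsC1Shape

variable {Ω : Set ℂ} {L r : ℝ} {γ : ℝ → ℂ}

theorem framePoint_notMem_frontier (h : IsC1Shape Ω L γ) (hn : NoncriticalCurve γ L r) (s : ℝ)
    {ρ θ : ℝ} (hρ : ρ ∈ Set.Ioc 0 r)
    (hθ : θ ∈ Set.Ioo (backAngle γ r s ρ - 2 * Real.pi) (foreAngle γ r s ρ) ∪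
      Set.Ioo (foreAngle γ r s ρ) (backAngle γ r s ρ)) :
    framePoint γ s ρ θ ∉ frontier Ω := by
  rcases hθ with hθ | hθ
  · exact fun hf => h.framePoint_notMem hn s hρ hθ (h.isCompact.isClosed.frontier_subset hf)
  · exact fun hf => hf.2 (h.framePoint_mem_interior hn s hρ hθ)

theorem ae_framePoint_notMem_frontier (h : IsC1Shape Ω L γ) (hn : NoncriticalCurve γ L r)
    (s : ℝ) {ρ : ℝ} (hρ : ρ ∈ Set.Ioc 0 r) :
    ∀ᵐ θ : ℝ, framePoint γ s ρ θ ∉ frontier Ω := by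
  set α := foreAngle γ r s ρ
  set β := backAngle γ r s ρ
  have hcount : (Set.range (fun n : ℤ => α - n • (2 * Real.pi)) ∪
      Set.range (fun n : ℤ => β - n • (2 * Real.pi))).Countable :=
    (Set.countable_range _).union (Set.countable_range _)
  filter_upwards [hcount.ae_notMem MeasureTheory.volume] with θ hθ
  obtain ⟨n, hn', -⟩ := existsUnique_add_zsmul_mem_Ioc Real.two_pi_pos θ (β - 2 * Real.pi)
  rw [← (framePoint_periodic γ s ρ).zsmul n θ]
  have h1 : θ + n • (2 * Real.pi) ≠ α := fun h2 => hθ (Or.inl ⟨n, by rw [← h2]; ring⟩)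
  have h2 : θ + n • (2 * Real.pi) ≠ β := fun h2 => hθ (Or.inr ⟨n, by rw [← h2]; ring⟩)
  refine h.framePoint_notMem_frontier hn s hρ ?_
  rcases lt_or_gt_of_ne h1 with h3 | h3
  · exact Or.inl ⟨hn'.1, h3⟩
  · exact Or.inr ⟨h3, lt_of_le_of_ne (by linarith [hn'.2]) h2⟩

theorem setIntegral_polarDensity_mul (h : IsC1Shape Ω L γ) (hn : NoncriticalCurve γ L r)
    (s : ℝ) {ρ : ℝ} (hρ : ρ ∈ Set.Ioc 0 r) {φ : ℝ → ℝ} (hφ : Continuous φ)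
    (hper : Function.Periodic φ (2 * Real.pi)) :
    ∫ θ in Set.Ioo (-Real.pi) Real.pi, polarDensity Ω (γ s) (deriv γ s) θ ρ * φ θ =
      ρ * ∫ θ in foreAngle γ r s ρ..backAngle γ r s ρ, φ θ := by
  have hα := hn.foreAngle_mem s hρ
  have hβ := hn.backAngle_mem s hρ
  have hpi := Real.pi_pos
  set α := foreAngle γ r s ρ with hα'
  set β := backAngle γ r s ρ with hβ'
  set F : ℝ → ℝ := fun θ => polarDensity Ω (γ s) (deriv γ s) θ ρ * φ θ with hF
  have hFe : ∀ θ, F θ = ρ * Ω.indicator 1 (framePoint γ s ρ θ) * φ θ := fun θ => rfl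
  have hFper : Function.Periodic F (2 * Real.pi) := fun θ => by
    rw [hFe, hFe, framePoint_periodic γ s ρ θ, hper θ]
  have hFm : Measurable F :=
    ((measurable_polarDensity h.isCompact.isClosed.measurableSet _ _).comp
      measurable_prodMk_right).mul hφ.measurable
  have hFi : ∀ a b, IntervalIntegrable F MeasureTheory.volume a b := fun a b =>
    ((hφ.intervalIntegrable a b).const_mul |ρ|).mono_fun hFm.aestronglyMeasurable
      (Filter.Eventually.of_forall fun θ => by
        simp only [hF, norm_mul, Real.norm_eq_abs, abs_abs]
        exact mul_le_mul_of_nonneg_right (norm_polarDensity_le _ _ _ _ _) (abs_nonneg _))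
  -- The window is moved by periodicity so that the exit angles cut it into one outer and one inner
  -- interval.
  have h1 : ∫ θ in Set.Ioo (-Real.pi) Real.pi, F θ = ∫ θ in (β - 2 * Real.pi)..β, F θ := by
    rw [← MeasureTheory.integral_Ioc_eq_integral_Ioo,
      ← intervalIntegral.integral_of_le (by linarith)]
    have := hFper.intervalIntegral_add_eq (-Real.pi) (β - 2 * Real.pi)
    rw [sub_add_cancel, show -Real.pi + 2 * Real.pi = Real.pi by ring] at this
    exact this
  have h2 : ∫ θ in (β - 2 * Real.pi)..α, F θ = 0 := by
    rw [intervalIntegral.integral_of_le (by linarith [hα.1, hβ.2]),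
      MeasureTheory.integral_Ioc_eq_integral_Ioo]
    refine MeasureTheory.setIntegral_eq_zero_of_forall_eq_zero fun θ hθ => ?_
    rw [hFe, Set.indicator_of_notMem (h.framePoint_notMem hn s hρ hθ)]
    simp
  have h3 : ∫ θ in α..β, F θ = ∫ θ in α..β, ρ * φ θ := by
    rw [intervalIntegral.integral_of_le (by linarith [hα.2, hβ.1]),
      intervalIntegral.integral_of_le (by linarith [hα.2, hβ.1]),
      MeasureTheory.integral_Ioc_eq_integral_Ioo, MeasureTheory.integral_Ioc_eq_integral_Ioo]
    refine MeasureTheory.setIntegral_congr_fun measurableSet_Ioo fun θ hθ => ?_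
    rw [hFe, Set.indicator_of_mem (interior_subset (h.framePoint_mem_interior hn s hρ hθ))]
    simp
  rw [h1, ← intervalIntegral.integral_add_adjacent_intervals (hFi _ α) (hFi α _), h2, h3,
    zero_add, intervalIntegral.integral_const_mul]

/-- The derivative is the length of the circular arc inside `Ω`. Only the circle of radius `ρ`
itself is involved, so `ρ = r` is allowed. -/
theorem hasDerivAt_areaInvariant_radius (h : IsC1Shape Ω L γ) (hn : NoncriticalCurve γ L r)
    (s : ℝ) {ρ : ℝ} (hρ : ρ ∈ Set.Ioc 0 r) :
    HasDerivAt (fun x => areaInvariant Ω γ s x)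
      (ρ * (backAngle γ r s ρ - foreAngle γ r s ρ)) ρ := by
  have key := hasDerivAt_volume_inter_closedBall h.isCompact.isClosed (γ s) (h.unit_speed s)
    (hasDerivAt_const ρ (0 : ℂ)) (hasDerivAt_id ρ) rfl hρ.1
    (MeasureTheory.ae_restrict_of_ae (h.ae_framePoint_notMem_frontier hn s hρ))
  have h1 := h.setIntegral_polarDensity_mul hn s hρ (φ := fun _ => 1) continuous_const
    (fun _ => rfl)
  simp only [mul_one, intervalIntegral.integral_const, smul_eq_mul] at h1
  simp only [zero_mul, Complex.zero_re, zero_add, mul_one, id] at key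
  rw [h1] at key
  refine key.congr_of_eventuallyEq (Filter.Eventually.of_forall fun x => ?_)
  simp [areaInvariant]

/-- Moving the centre along the tangent pushes the circle outward at rate `cos θ` in direction `θ`;
integrating over the inner arc gives the difference of sines. -/
theorem hasDerivAt_areaInvariant_time (h : IsC1Shape Ω L γ) (hn : NoncriticalCurve γ L r)
    (s : ℝ) {ρ : ℝ} (hρ : ρ ∈ Set.Ioc 0 r) :
    HasDerivAt (fun x => areaInvariant Ω γ x ρ)
      (ρ * (Real.sin (backAngle γ r s ρ) - Real.sin (foreAngle γ r s ρ))) s := by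
  have hne := hn.deriv_ne_zero s
  have hv : HasDerivAt (fun x => (γ x - γ s) / deriv γ s) 1 s :=
    (((h.hasDerivAt s).sub_const (γ s)).div_const (deriv γ s)).congr_deriv (div_self hne)
  have key := hasDerivAt_volume_inter_closedBall h.isCompact.isClosed (γ s) (h.unit_speed s)
    hv (hasDerivAt_const s ρ) (by simp) hρ.1
    (MeasureTheory.ae_restrict_of_ae (h.ae_framePoint_notMem_frontier hn s hρ))
  have h1 := h.setIntegral_polarDensity_mul hn s hρ (φ := Real.cos) Real.continuous_cos
    Real.cos_periodic
  have h2 : ∀ θ : ℝ, (1 * Complex.exp (-θ * Complex.I)).re + 0 = Real.cos θ := fun θ => by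
    rw [one_mul, add_zero, ← Complex.ofReal_neg, Complex.exp_ofReal_mul_I_re, Real.cos_neg]
  simp only [h2, h1, integral_cos] at key
  refine key.congr_of_eventuallyEq (Filter.Eventually.of_forall fun x => ?_)
  simp [areaInvariant, mul_div_cancel₀ _ hne]

end IsC1Shape

/-! ### Recovering the exit angle, and conclusion. -/

theorem eq_of_sub_eq_of_sin_sub_sin_eq {α₁ β₁ α₂ β₂ : ℝ}
    (hα₁ : α₁ ∈ Set.Ioo (-(Real.pi / 2)) (Real.pi / 2))
    (hβ₁ : β₁ ∈ Set.Ioo (Real.pi / 2) (3 * Real.pi / 2))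
    (hα₂ : α₂ ∈ Set.Ioo (-(Real.pi / 2)) (Real.pi / 2))
    (hβ₂ : β₂ ∈ Set.Ioo (Real.pi / 2) (3 * Real.pi / 2))
    (h1 : β₁ - α₁ = β₂ - α₂)
    (h2 : Real.sin β₁ - Real.sin α₁ = Real.sin β₂ - Real.sin α₂) : α₁ = α₂ := by
  obtain ⟨a1, a2⟩ := hα₁
  obtain ⟨b1, b2⟩ := hβ₁
  obtain ⟨c1, c2⟩ := hα₂
  obtain ⟨d1, d2⟩ := hβ₂
  rw [Real.sin_sub_sin, Real.sin_sub_sin, h1] at h2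
  -- The half difference lies in `(0, π)`, so the product formula can be divided by its sine; the
  -- half sum also lies in `(0, π)`, where cosine is injective.
  have hs : 0 < Real.sin ((β₂ - α₂) / 2) :=
    Real.sin_pos_of_pos_of_lt_pi (by linarith) (by linarith)
  have h3 := mul_left_cancel₀ (mul_pos two_pos hs).ne' h2
  have h4 := Real.injOn_cos ⟨by linarith, by linarith⟩ ⟨by linarith, by linarith⟩ h3
  linarith

theorem exitPoint_eq_of_deriv_areaInvariant_eq {Ω₁ Ω₂ : Set ℂ} {L r : ℝ} {γ₁ γ₂ : ℝ → ℂ}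
    (h₁ : IsC1Shape Ω₁ L γ₁) (h₂ : IsC1Shape Ω₂ L γ₂) (hn₁ : NoncriticalCurve γ₁ L r)
    (hn₂ : NoncriticalCurve γ₂ L r) {s ρ : ℝ} (hρ : ρ ∈ Set.Ioc 0 r)
    (hs : deriv (fun x => areaInvariant Ω₁ γ₁ x ρ) s = deriv (fun x => areaInvariant Ω₂ γ₂ x ρ) s)
    (hr : deriv (fun x => areaInvariant Ω₁ γ₁ s x) ρ =
      deriv (fun x => areaInvariant Ω₂ γ₂ s x) ρ) :
    exitPoint γ₁ r s ρ = exitPoint γ₂ r s ρ := by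
  rw [(h₁.hasDerivAt_areaInvariant_time hn₁ s hρ).deriv,
    (h₂.hasDerivAt_areaInvariant_time hn₂ s hρ).deriv] at hs
  rw [(h₁.hasDerivAt_areaInvariant_radius hn₁ s hρ).deriv,
    (h₂.hasDerivAt_areaInvariant_radius hn₂ s hρ).deriv] at hr
  have hα := eq_of_sub_eq_of_sin_sub_sin_eq (hn₁.foreAngle_mem s hρ) (hn₁.backAngle_mem s hρ)
    (hn₂.foreAngle_mem s hρ) (hn₂.backAngle_mem s hρ)
    (mul_left_cancel₀ hρ.1.ne' hr) (mul_left_cancel₀ hρ.1.ne' hs)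
  unfold foreAngle at hα
  rw [hn₁.exitPoint_eq s hρ, hn₂.exitPoint_eq s hρ, hα]

theorem mainTheorem8 (L rhat shat : ℝ) (hr : 0 < rhat) (hs : shat ∈ Set.Icc 0 L)
    (Ω₁ Ω₂ : Set ℂ) (γ₁ γ₂ : ℝ → ℂ)
    (h₁ : IsC1Shape Ω₁ L γ₁) (h₂ : IsC1Shape Ω₂ L γ₂)
    (htgl₁ : IsTGL (frontier Ω₁) rhat) (htgl₂ : IsTGL (frontier Ω₂) rhat)
    (hg : ∀ q ∈ tSet L rhat shat,
      areaInvariant Ω₁ γ₁ q.1 q.2 = areaInvariant Ω₂ γ₂ q.1 q.2)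
    (hgs : ∀ q ∈ tSet L rhat shat,
      deriv (fun s : ℝ => areaInvariant Ω₁ γ₁ s q.2) q.1 =
        deriv (fun s : ℝ => areaInvariant Ω₂ γ₂ s q.2) q.1)
    (hgr : ∀ q ∈ tSet L rhat shat,
      deriv (fun r : ℝ => areaInvariant Ω₁ γ₁ q.1 r) q.2 =
        deriv (fun r : ℝ => areaInvariant Ω₂ γ₂ q.1 r) q.2) :
    ∃ a b : ℂ, ‖a‖ = 1 ∧ ∀ s ∈ Set.Icc 0 L, γ₂ s = a * γ₁ s + b := by
  have hn₁ := h₁.noncriticalCurve hr htgl₁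
  have hn₂ := h₂.noncriticalCurve hr htgl₂
  have hdata : ∀ q ∈ tSet L rhat shat, q.2 ∈ Set.Ioc 0 rhat →
      exitPoint γ₁ rhat q.1 q.2 = exitPoint γ₂ rhat q.1 q.2 := fun q hq hq2 =>
    exitPoint_eq_of_deriv_areaInvariant_eq h₁ h₂ hn₁ hn₂ hq2 (hgs q hq) (hgr q hq)
  -- The reconstruction runs past `L`, so the data on the bar of the T are extended periodically.
  have hall : ∀ s, exitPoint γ₁ rhat s rhat = exitPoint γ₂ rhat s rhat := by
    intro s
    obtain ⟨n, hmem, -⟩ := existsUnique_add_zsmul_mem_Ico h₁.length_pos s 0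
    rw [zero_add] at hmem
    have hq : (s + n • L, rhat) ∈ tSet L rhat shat := Or.inl ⟨⟨hmem.1, hmem.2.le⟩, rfl⟩
    have hper : ∀ {Ω : Set ℂ} {γ : ℝ → ℂ}, IsC1Shape Ω L γ → ∀ x ρ,
        areaInvariant Ω γ (x + n • L) ρ = areaInvariant Ω γ x ρ := fun h x ρ => by
      unfold areaInvariant
      rw [h.periodic.zsmul n x]
    refine exitPoint_eq_of_deriv_areaInvariant_eq h₁ h₂ hn₁ hn₂ ⟨hr, le_rfl⟩ ?_ ?_
    · have e := hgs _ hq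
      dsimp only at e
      rw [← deriv_comp_add_const, ← deriv_comp_add_const] at e
      simpa only [hper h₁, hper h₂] using e
    · simpa only [hper h₁, hper h₂] using hgr _ hq
  obtain ⟨a, b, ha, hab⟩ := hn₁.congr_of_exitPoint_eq hn₂ shat hall
    fun ρ hρ => hdata (shat, ρ) (Or.inr ⟨rfl, hρ⟩) hρ
  exact ⟨a, b, ha, fun s _ => hab s⟩
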